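/- Definitions. Let $E$ be a finite-dimensional complex vector space with a nondegenerate symmetric bilinear form $h$. A Lie subalgebra $\mathfrak g\subset\mathfrak{so}(E,h)$ is called weak-Berger if $\mathfrak g=\mathrm{span}\{Q(x)\mid x\in E,\ Q\in\mathcal B_h(\mathfrak g)\}$, where $\mathcal B_h(\mathfrak g)$ is the space of linear maps $Q:E\to\mathfrak g$ with $h(Q(x)y,z)+h(Q(y)z,x)+h(Q(z)x,y)=0$ for all $x,y,z\in E$. For Lie algebras $\mathfrak g_i\subset\mathfrak{gl}(V_i)$, the sum $\mathfrak g_1\oplus\mathfrak g_2$ acts on $V_1\otimes V_2$ by $(A,B)\mapsto A\otimes 1+1\otimes B$; $\mathfrak{sl}(2,\mathbb C)$ and $\mathfrak{so}(n,\mathbb C)$ act on $\mathbb C^2$ and $\mathbb C^n$ in the standard way. For $\mathfrak g_2\subset\mathfrak{gl}(V_2)$ with a Cartan subalgebra $\mathfrak t_2$, let $\Omega^2\subset\mathfrak t_2^*$ be the set of weights of $V_2$, let $\Delta^2\subset\mathfrak t_2^*$ be the set of roots of $\mathfrak g_2$, and put $\Delta^2_0=\Delta^2\cup\{0\}$. Consider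 the properties: (PIII) there are $\mu\in\Omega^2$ and an affine hyperplane $A\subset\mathfrak t_2^*$ such that $\Omega^2\subset\{\mu+\beta\mid\beta\in\Delta^2_0\}\cup A\cup\{-\mu\}$; (PIV) there is $\mu\in\Omega^2$ such that $\Omega^2\subset\{\mu+\beta\mid\beta\in\Delta^2_0\}\cup\{-\mu+\beta\mid\beta\in\Delta^2_0\}$. Proposition 2.12. Let $V_2$ be a finite-dimensional complex vector space, let $\mathfrak g_2\subset\mathfrak{gl}(V_2)$ be a complex Lie algebra, and let $\mathfrak g=\mathfrak{sl}(2,\mathbb C)\oplus\mathfrak g_2$ act on $V=\mathbb C^2\otimes V_2$. Suppose that $\mathfrak g$ is semisimple, acts irreducibly on $V$, and is a weak-Berger algebra in $\mathfrak{so}(V,h)$ for a nondegenerate symmetric bilinear form $h$ on $V$. Then at least one of the following holds: (1) $\mathfrak g_2$ is simple, acts irreducibly on $V_2$, preserves a nondegenerate alternating bilinear form on $V_2$, and satisfies (PIII) and (PIV) with respect to every Cartan subalgebra $\mathfrak t_2$ of $\mathfrak g_2$; (2) for some $n\ge 3$ there are linear isomorphisms $V_2\cong\mathbb C^2\otimes\mathbb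 C^n$ and $\mathbb C^2\otimes\mathbb C^2\cong\mathbb C^4$ under which $\mathfrak g_2$ becomes $\mathfrak{sl}(2,\mathbb C)\oplus\mathfrak{so}(n,\mathbb C)$ acting on $\mathbb C^2\otimes\mathbb C^n$ and $\mathfrak{sl}(2,\mathbb C)\oplus\mathfrak{sl}(2,\mathbb C)$ acting on $\mathbb C^2\otimes\mathbb C^2$ becomes $\mathfrak{so}(4,\mathbb C)$ acting on $\mathbb C^4$, so that under the induced isomorphism $V\cong\mathbb C^2\otimes\mathbb C^2\otimes\mathbb C^n\cong\mathbb C^4\otimes\mathbb C^n$ the algebra $\mathfrak g$ becomes $\mathfrak{so}(4,\mathbb C)\oplus\mathfrak{so}(n,\mathbb C)$ acting on $\mathbb C^4\otimes\mathbb C^n$. -/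

import Mathlib

open scoped TensorProduct

attribute [local instance 100] LieRing.ofAssociativeRing

namespace WeakBerger

section General

variable {K E : Type*} [Field K] [AddCommGroup E] [Module K E]

/-- `B_h(g)`: linear maps `Q : E → g` with
`h (Q(x) y, z) + h (Q(y) z, x) + h (Q(z) x, y) = 0`. -/
def curvatureSpace (h : LinearMap.BilinForm K E) (g : LieSubalgebra K (Module.End K E)) :
    Submodule K (E →ₗ[K] g) where
  carrier := {Q | ∀ x y z : E,
    h ((Q x : Module.End K E) y) z + h ((Q y : Module.End K E) z) x
      + h ((Q z : Module.End K E) x) y = 0}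
  zero_mem' := by intro x y z; simp
  add_mem' := by
    intro P Q hP hQ x y z
    have h1 := hP x y z
    have h2 := hQ x y z
    simp only [LinearMap.add_apply, AddMemClass.coe_add, map_add] at *
    linear_combination h1 + h2
  smul_mem' := by
    intro c Q hQ x y z
    have h1 := hQ x y z
    simp only [LinearMap.smul_apply, SetLike.val_smul, map_smul, smul_eq_mul] at *
    linear_combination c * h1

/-- `g ⊆ so(E, h)`, with `h` symmetric and nondegenerate, is a weak-Berger algebra:
`g` is spanned by the values `Q(x)`, where `x ∈ E` and `Q ∈ B_h(g)`. -/
structure IsWeakBerger (h : LinearMap.BilinForm K E)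
    (g : LieSubalgebra K (Module.End K E)) : Prop where
  isSymm : h.IsSymm
  nondegenerate : h.Nondegenerate
  le_so : g ≤ skewAdjointLieSubalgebra h
  span_eq_top : Submodule.span K {A : g | ∃ Q ∈ curvatureSpace h g, ∃ x : E, Q x = A} = ⊤

/-- `g` acts symplectically: it is contained in `sp(E, ω)` for some nondegenerate
alternating bilinear form `ω`. -/
def IsSymplectic (g : LieSubalgebra K (Module.End K E)) : Prop :=
  ∃ ω : LinearMap.BilinForm K E, ω.IsAlt ∧ ω.Nondegenerate ∧ g ≤ skewAdjointLieSubalgebra ω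

/-- An affine hyperplane (not necessarily through the origin) of a vector space. -/
def IsAffineHyperplane (A : Set E) : Prop :=
  ∃ f : Module.Dual K E, f ≠ 0 ∧ ∃ c : K, A = {w | f w = c}

end General

section Tensor

variable {K V₁ V₂ : Type*} [Field K] [AddCommGroup V₁] [Module K V₁]
  [AddCommGroup V₂] [Module K V₂]

/-- The Lie algebra `g₁ ⊕ g₂` acting on `V₁ ⊗ V₂`: all endomorphisms
`A ⊗ 1 + 1 ⊗ B` with `A ∈ g₁` and `B ∈ g₂`. -/
def tensorSum (g₁ : LieSubalgebra K (Module.End K V₁)) (g₂ : LieSubalgebra K (Module.End K V₂)) :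
    LieSubalgebra K (Module.End K (V₁ ⊗[K] V₂)) where
  carrier := {T | ∃ A ∈ g₁, ∃ B ∈ g₂, T = A.rTensor V₂ + B.lTensor V₁}
  zero_mem' := ⟨0, g₁.zero_mem, 0, g₂.zero_mem, by simp⟩
  add_mem' := by
    rintro _ _ ⟨A, hA, B, hB, rfl⟩ ⟨A', hA', B', hB', rfl⟩
    refine ⟨A + A', g₁.add_mem hA hA', B + B', g₂.add_mem hB hB', ?_⟩
    rw [LinearMap.rTensor_add, LinearMap.lTensor_add]
    abel
  smul_mem' := by
    rintro c _ ⟨A, hA, B, hB, rfl⟩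
    refine ⟨c • A, g₁.smul_mem c hA, c • B, g₂.smul_mem c hB, ?_⟩
    rw [LinearMap.rTensor_smul, LinearMap.lTensor_smul, smul_add]
  lie_mem' := by
    rintro _ _ ⟨A, hA, B, hB, rfl⟩ ⟨A', hA', B', hB', rfl⟩
    refine ⟨⁅A, A'⁆, g₁.lie_mem hA hA', ⁅B, B'⁆, g₂.lie_mem hB hB', ?_⟩
    ext v w
    simp only [Ring.lie_def, TensorProduct.AlgebraTensorModule.curry_apply,
      TensorProduct.curry_apply, LinearMap.sub_apply,
      Module.End.mul_apply, LinearMap.add_apply, LinearMap.rTensor_tmul, LinearMap.lTensor_tmul,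
      map_add, TensorProduct.sub_tmul, TensorProduct.tmul_sub,
      LinearMap.restrictScalars_self]
    abel

end Tensor

/-- A Lie algebra of matrices, acting on column vectors. -/
def ofMatrices {ι : Type*} [Fintype ι] [DecidableEq ι] (g : LieSubalgebra ℂ (Matrix ι ι ℂ)) :
    LieSubalgebra ℂ (Module.End ℂ (ι → ℂ)) :=
  g.map (lieEquivMatrix' (R := ℂ) (n := ι)).symm.toLieHom

/-- `sl(2, ℂ)` acting on `ℂ²`. -/
def sl2 : LieSubalgebra ℂ (Module.End ℂ (Fin 2 → ℂ)) :=
  ofMatrices (LieAlgebra.SpecialLinear.sl (Fin 2) ℂ)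

/-- `so(n, ℂ)` acting on `ℂⁿ`. -/
def so (n : ℕ) : LieSubalgebra ℂ (Module.End ℂ (Fin n → ℂ)) :=
  ofMatrices (LieAlgebra.Orthogonal.so (Fin n) ℂ)

section Weights

variable {V : Type*} [AddCommGroup V] [Module ℂ V]
  (g : LieSubalgebra ℂ (Module.End ℂ V)) (t : LieSubalgebra ℂ g) [t.IsCartanSubalgebra]

/-- `Ω`: the weights of `g ⊆ gl(V)` with respect to the Cartan subalgebra `t`, in `t*`. -/
def weights : Set (Module.Dual ℂ t) :=
  {μ | ∃ w : LieModule.Weight ℂ t V, (w : t → ℂ) = μ}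

/-- `Δ₀ = Δ ∪ {0}`, where `Δ` is the set of roots (the nonzero weights of `t` on `g`). -/
def rootsWithZero : Set (Module.Dual ℂ t) :=
  {β | ∃ w : LieModule.Weight ℂ t g, w.IsNonZero ∧ (w : t → ℂ) = β} ∪ {0}

/-- There are a weight `μ` and an affine hyperplane `A ⊆ t*` such that
`Ω ⊆ (μ + Δ₀) ∪ A ∪ {-μ}`. -/
def PropertyPIII : Prop :=
  ∃ μ ∈ weights g t, ∃ A : Set (Module.Dual ℂ t), IsAffineHyperplane (K := ℂ) A ∧
    weights g t ⊆ {ν | ∃ β ∈ rootsWithZero g t, ν = μ + β} ∪ A ∪ {-μ}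

/-- There is a weight `μ` such that `Ω ⊆ (μ + Δ₀) ∪ (-μ + Δ₀)`. -/
def PropertyPIV : Prop :=
  ∃ μ ∈ weights g t,
    weights g t ⊆ {ν | ∃ β ∈ rootsWithZero g t, ν = μ + β} ∪
      {ν | ∃ β ∈ rootsWithZero g t, ν = -μ + β}

end Weights

end WeakBerger

/-!
Write `F` for `V₂` and `g` for `g₂`. Since `sl(2)` preserves only the area form `ω` on `ℂ²`, up to a
scalar, the symmetric form on `ℂ² ⊗ F` is `ω ⊗ σ` for a symplectic form `σ` on `F` that is invariant
under `g` (`exists_symplectic`). Moreover `g` acts irreducibly on `F`, hence is semisimple.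

The heart of the matter is the notion of a *curvature pair*: a linear map `A : F → g` and a vector
`a ∈ F` such that `A(u) v - A(v) u = σ(a, v) u - σ(a, u) v + 2 σ(u, v) a`. If `dim F ≥ 3`, the
cyclic identity for a weak curvature map of `sl(2) ⊕ g` says that its `sl(2)`-part is given by
vectors of `F`, and that its `g`-part forms curvature pairs with these vectors
(`curvature_components`). As the values of the weak curvature maps span `sl(2) ⊕ g`, there is a
curvature pair with `a ≠ 0` (`exists_isCurvaturePair`). Curvature pairs form a `g`-module, so by
irreducibility every vector of `F` belongs to one (`forall_exists_isCurvaturePair`).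

If `g` is simple, take a curvature pair that is homogeneous under the Cartan subalgebra, with `a` of
weight `μ`. Then `A(v)` has weight `μ + ν` for `v` of weight `ν`, so `A(v) = 0` unless `μ + ν` is a
root or zero. Feeding weight vectors into the defining identity gives both weight conditions
(`properties_of_isCurvaturePair`); for (PIII) the hyperplane is cut out by the element `A(u)` of the
Cartan subalgebra, where `u` has weight `-μ` and `σ(a, u) ≠ 0`. If `dim F ≤ 2` the only weights are
`±μ` (`properties_of_finrank_le_two`).

If `g` is not simple, it is the sum of two commuting ideals, and `F` is a tensor product `M ⊗ N` on
whose factors they act (`exists_tensor_equiv`). By Schur's lemma `σ` is the product of an alternating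
form on `M` and a symmetric form on `N` (`exists_symplectic_tensorSum_orthogonal`). Neither ideal is
abelian, so `dim M ≥ 2` and `dim N ≥ 3`. A decomposable functional applied to the identity of a
curvature pair excludes `dim M ≥ 3` (`not_forall_curvature_of_three_le_finrank`), and for `M = ℂ²`
the curvature pairs produce all of `sl(2)` and all of `so(n)` (`eq_sl2_and_eq_so`). Finally
`sl(2) ⊕ sl(2)` on `ℂ² ⊗ ℂ²` is `so(4)` (`exists_equiv_so_four`).
-/

namespace WeakBerger

open LinearMap (BilinForm)

/-! ### Skew-adjoint endomorphisms -/

section SkewAdjoint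

variable {K M : Type*} [Field K] [AddCommGroup M] [Module K M]

theorem mem_skewAdjoint_iff (B : BilinForm K M) (T : Module.End K M) :
    T ∈ skewAdjointLieSubalgebra B ↔ ∀ x y, B (T x) y = -B x (T y) := by
  change T ∈ B.skewAdjointSubmodule ↔ _
  rw [LinearMap.mem_skewAdjointSubmodule]
  simp [LinearMap.IsSkewAdjoint, LinearMap.IsAdjointPair]

theorem nondegenerate_of_isRefl {B : BilinForm K M} (hB : B.IsRefl)
    (h : ∀ x, (∀ y, B x y = 0) → x = 0) : B.Nondegenerate :=
  ⟨h, fun y hy => h y fun x => hB _ _ (hy x)⟩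

/-- The infinitesimal rotation `a ∧ v` attached to a bilinear form `B`:
`u ↦ B(a, u) v - B(v, u) a`. -/
def wedge (B : BilinForm K M) : M →ₗ[K] M →ₗ[K] Module.End K M :=
  LinearMap.mk₂ K (fun a v => (B a).smulRight v - (B v).smulRight a)
    (by intro a b v; ext u; simp [add_smul]; abel)
    (by intro c a v; ext u; simp [mul_smul, smul_sub, smul_comm c])
    (by intro a v w; ext u; simp [add_smul]; abel)
    (by intro c a v; ext u; simp [mul_smul, smul_sub, smul_comm c])

@[simp]
theorem wedge_apply (B : BilinForm K M) (a v u : M) :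
    wedge B a v u = B a u • v - B v u • a := by
  simp [wedge]

end SkewAdjoint

/-! ### The standard forms and the Lie algebras `sl(2)` and `so(n)` -/

section StandardForms

/-- The standard area form `x₀ y₁ - x₁ y₀` on `ℂ²`. -/
def areaForm : BilinForm ℂ (Fin 2 → ℂ) :=
  LinearMap.mk₂ ℂ (fun x y => x 0 * y 1 - x 1 * y 0)
    (by intro x y z; simp; ring) (by intro c x y; simp; ring)
    (by intro x y z; simp; ring) (by intro c x y; simp; ring)

@[simp]
theorem areaForm_apply (x y : Fin 2 → ℂ) : areaForm x y = x 0 * y 1 - x 1 * y 0 := rfl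

/-- The standard symmetric bilinear form on `ℂⁿ`. -/
def dotForm (n : ℕ) : BilinForm ℂ (Fin n → ℂ) :=
  dotProductBilin ℂ ℂ

@[simp]
theorem dotForm_apply {n : ℕ} (x y : Fin n → ℂ) : dotForm n x y = x ⬝ᵥ y := rfl

theorem mem_sl2_iff (T : Module.End ℂ (Fin 2 → ℂ)) :
    T ∈ sl2 ↔ T (Pi.single 0 1) 0 + T (Pi.single 1 1) 1 = 0 := by
  have key : LinearMap.toMatrix' T ∈ LieAlgebra.SpecialLinear.sl (Fin 2) ℂ ↔
      T (Pi.single 0 1) 0 + T (Pi.single 1 1) 1 = 0 := by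
    change Matrix.trace (LinearMap.toMatrix' T) = 0 ↔ _
    simp [Matrix.trace, LinearMap.toMatrix'_apply]
  rw [← key]
  constructor
  · rintro ⟨A, hA, rfl⟩
    simpa using hA
  · intro h
    exact ⟨_, h, by simp⟩

theorem sl2_le_skewAdjoint : sl2 ≤ skewAdjointLieSubalgebra areaForm := by
  intro T hT
  rw [mem_sl2_iff] at hT
  rw [mem_skewAdjoint_iff]
  have hx : ∀ x : Fin 2 → ℂ, x = x 0 • Pi.single 0 1 + x 1 • Pi.single 1 1 := by
    intro x; ext i; fin_cases i <;> simp
  intro x y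
  have h1 : T x = x 0 • T (Pi.single 0 1) + x 1 • T (Pi.single 1 1) := by
    conv_lhs => rw [hx x]
    simp
  have h2 : T y = y 0 • T (Pi.single 0 1) + y 1 • T (Pi.single 1 1) := by
    conv_lhs => rw [hx y]
    simp
  simp only [areaForm_apply, h1, h2, Pi.add_apply, Pi.smul_apply, smul_eq_mul]
  linear_combination (x 0 * y 1 - x 1 * y 0) * hT

theorem skewAdjoint_areaForm : skewAdjointLieSubalgebra areaForm = sl2 := by
  refine le_antisymm (fun T hT => ?_) sl2_le_skewAdjoint
  rw [mem_skewAdjoint_iff] at hT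
  rw [mem_sl2_iff]
  have := hT (Pi.single 0 1) (Pi.single 1 1)
  simp at this
  linear_combination this

/-- `sl(2)` is spanned by the rank-one maps `v ↦ ω(x, v) x`. -/
theorem sl2_le_of_smulRight_mem (g : LieSubalgebra ℂ (Module.End ℂ (Fin 2 → ℂ)))
    (hg : ∀ x, (areaForm x).smulRight x ∈ g) : sl2 ≤ g := by
  intro T hT
  rw [mem_sl2_iff] at hT
  set p := T (Pi.single 0 1) 0 with hp
  set q := T (Pi.single 1 1) 0 with hq
  set r := T (Pi.single 0 1) 1 with hr
  have h0 := hg (Pi.single 0 1)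
  have h1 := hg (Pi.single 1 1)
  have h2 := hg (Pi.single 0 1 + Pi.single 1 1)
  have : T = q • (areaForm (Pi.single 0 1)).smulRight (Pi.single 0 1)
      - r • (areaForm (Pi.single 1 1)).smulRight (Pi.single 1 1)
      - p • ((areaForm (Pi.single 0 1 + Pi.single 1 1)).smulRight (Pi.single 0 1 + Pi.single 1 1)
        - (areaForm (Pi.single 0 1)).smulRight (Pi.single 0 1)
        - (areaForm (Pi.single 1 1)).smulRight (Pi.single 1 1)) := by
    refine LinearMap.pi_ext' fun i => LinearMap.ext_ring ?_
    ext j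
    fin_cases i <;> fin_cases j <;> simp [← hp, ← hq, ← hr]
    linear_combination hT
  rw [this]
  exact sub_mem (sub_mem (g.smul_mem _ h0) (g.smul_mem _ h1))
    (g.smul_mem _ (sub_mem (sub_mem h2 h0) h1))

theorem skewAdjoint_dotForm (n : ℕ) : skewAdjointLieSubalgebra (dotForm n) = so n := by
  ext T
  have key : LinearMap.toMatrix' T ∈ LieAlgebra.Orthogonal.so (Fin n) ℂ ↔
      ∀ i j, T (Pi.single i 1) j = - T (Pi.single j 1) i := by
    rw [LieAlgebra.Orthogonal.mem_so]
    rw [← Matrix.ext_iff]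
    simp [LinearMap.toMatrix'_apply]
  have h2 : T ∈ so n ↔ LinearMap.toMatrix' T ∈ LieAlgebra.Orthogonal.so (Fin n) ℂ := by
    constructor
    · rintro ⟨A, hA, rfl⟩
      simpa using hA
    · intro h
      exact ⟨_, h, by simp⟩
  rw [h2, key, mem_skewAdjoint_iff]
  constructor
  · intro h i j
    simpa using h (Pi.single i 1) (Pi.single j 1)
  · intro h x y
    have : (dotForm n).compl₁₂ T LinearMap.id = -(dotForm n).compl₁₂ LinearMap.id T := by
      refine LinearMap.pi_ext' fun i => LinearMap.ext_ring ?_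
      refine LinearMap.pi_ext' fun j => LinearMap.ext_ring ?_
      simp [h i j]
    simpa using LinearMap.congr_fun₂ this x y

/-- `so(n)` is spanned by the infinitesimal rotations `a ∧ v`. -/
theorem mem_span_wedge_of_mem_so {n : ℕ} {T : Module.End ℂ (Fin n → ℂ)} (hT : T ∈ so n) :
    T ∈ Submodule.span ℂ (Set.range fun p : (Fin n → ℂ) × (Fin n → ℂ) =>
      wedge (dotForm n) p.1 p.2) := by
  rw [← skewAdjoint_dotForm, mem_skewAdjoint_iff] at hT
  have : T = (1 / 2 : ℂ) • ∑ i, wedge (dotForm n) (Pi.single i 1) (T (Pi.single i 1)) := by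
    refine LinearMap.ext fun u => ?_
    have h1 : ∑ i, u i • T (Pi.single i 1) = T u := by
      conv_rhs => rw [pi_eq_sum_univ' u, map_sum]
      refine Finset.sum_congr rfl fun i _ => ?_
      rw [map_smul]
    have h2 : ∀ i, dotForm n (T (Pi.single i 1)) u = - T u i := by
      intro i; rw [hT]; simp
    simp only [LinearMap.smul_apply, LinearMap.sum_apply, wedge_apply, h2, Finset.sum_sub_distrib]
    simp only [dotForm_apply, single_one_dotProduct, h1, neg_smul, Finset.sum_neg_distrib]
    have h3 : ∑ i, (T u) i • (Pi.single i 1 : Fin n → ℂ) = T u := by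
      ext j; simp [Finset.sum_apply, Pi.single_apply]
    rw [h3]
    module
  rw [this]
  exact Submodule.smul_mem _ _ (Submodule.sum_mem _ fun i _ =>
    Submodule.subset_span ⟨(_, _), rfl⟩)

theorem so_le_of_wedge_mem {n : ℕ} (g : LieSubalgebra ℂ (Module.End ℂ (Fin n → ℂ)))
    (hg : ∀ a v, wedge (dotForm n) a v ∈ g) : so n ≤ g := by
  intro T hT
  refine (Submodule.span_le (p := g.toSubmodule)).2 ?_ (mem_span_wedge_of_mem_so hT)
  rintro _ ⟨p, rfl⟩
  exact hg _ _

end StandardForms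

/-! ### Transport of sums of Lie algebras acting on tensor products -/

section TensorSum

variable {K V₁ V₂ W₁ W₂ : Type*} [Field K] [AddCommGroup V₁] [Module K V₁]
  [AddCommGroup V₂] [Module K V₂] [AddCommGroup W₁] [Module K W₁] [AddCommGroup W₂] [Module K W₂]

theorem conj_congr_rTensor (e₁ : V₁ ≃ₗ[K] W₁) (e₂ : V₂ ≃ₗ[K] W₂) (A : Module.End K V₁) :
    (TensorProduct.congr e₁ e₂).conj (A.rTensor V₂) = (e₁.conj A).rTensor W₂ := by
  ext x y
  simp [LinearEquiv.conj_apply]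

theorem conj_congr_lTensor (e₁ : V₁ ≃ₗ[K] W₁) (e₂ : V₂ ≃ₗ[K] W₂) (B : Module.End K V₂) :
    (TensorProduct.congr e₁ e₂).conj (B.lTensor V₁) = (e₂.conj B).lTensor W₁ := by
  ext x y
  simp [LinearEquiv.conj_apply]

theorem mem_map_lieConj_iff (e : V₁ ≃ₗ[K] W₁) (g : LieSubalgebra K (Module.End K V₁))
    (T : Module.End K W₁) : T ∈ g.map e.lieConj.toLieHom ↔ e.symm.conj T ∈ g := by
  constructor
  · rintro ⟨A, hA, rfl⟩
    change e.symm.conj (e.conj A) ∈ g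
    simpa using hA
  · intro h
    exact ⟨_, h, by change e.conj (e.symm.conj T) = T; simp⟩

theorem tensorSum_map_congr (g₁ : LieSubalgebra K (Module.End K V₁))
    (g₂ : LieSubalgebra K (Module.End K V₂)) (e₁ : V₁ ≃ₗ[K] W₁) (e₂ : V₂ ≃ₗ[K] W₂) :
    (tensorSum g₁ g₂).map (TensorProduct.congr e₁ e₂).lieConj.toLieHom
      = tensorSum (g₁.map e₁.lieConj.toLieHom) (g₂.map e₂.lieConj.toLieHom) := by
  ext T
  constructor
  · rintro ⟨_, ⟨A, hA, B, hB, rfl⟩, rfl⟩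
    refine ⟨_, ⟨A, hA, rfl⟩, _, ⟨B, hB, rfl⟩, ?_⟩
    change (TensorProduct.congr e₁ e₂).conj _ = _
    rw [map_add, conj_congr_rTensor, conj_congr_lTensor]
    rfl
  · rintro ⟨_, ⟨A, hA, rfl⟩, _, ⟨B, hB, rfl⟩, rfl⟩
    refine ⟨_, ⟨A, hA, B, hB, rfl⟩, ?_⟩
    change (TensorProduct.congr e₁ e₂).conj _ = _
    rw [map_add, conj_congr_rTensor, conj_congr_lTensor]
    rfl

theorem tensorSum_map_assoc_symm (g₁ : LieSubalgebra K (Module.End K V₁))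
    (g₂ : LieSubalgebra K (Module.End K V₂)) (g₃ : LieSubalgebra K (Module.End K W₁)) :
    (tensorSum g₁ (tensorSum g₂ g₃)).map (TensorProduct.assoc K V₁ V₂ W₁).symm.lieConj.toLieHom
      = tensorSum (tensorSum g₁ g₂) g₃ := by
  have key : ∀ (A : Module.End K V₁) (B : Module.End K V₂) (C : Module.End K W₁),
      (TensorProduct.assoc K V₁ V₂ W₁).symm.conj
        (A.rTensor _ + (B.rTensor W₁ + C.lTensor V₂).lTensor V₁)
      = (A.rTensor V₂ + B.lTensor V₁).rTensor W₁ + C.lTensor _ := by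
    intro A B C
    ext x y z
    simp [LinearEquiv.conj_apply]
    abel
  ext T
  constructor
  · rintro ⟨_, ⟨A, hA, _, ⟨B, hB, C, hC, rfl⟩, rfl⟩, rfl⟩
    exact ⟨_, ⟨A, hA, B, hB, rfl⟩, C, hC, key A B C⟩
  · rintro ⟨_, ⟨A, hA, B, hB, rfl⟩, C, hC, rfl⟩
    exact ⟨_, ⟨A, hA, _, ⟨B, hB, C, hC, rfl⟩, rfl⟩, key A B C⟩

theorem map_lieConj_trans {X : Type*} [AddCommGroup X] [Module K X] (e : V₁ ≃ₗ[K] W₁)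
    (f : W₁ ≃ₗ[K] X) (g : LieSubalgebra K (Module.End K V₁)) :
    g.map (e.trans f).lieConj.toLieHom
      = (g.map e.lieConj.toLieHom).map f.lieConj.toLieHom := by
  ext T
  simp only [mem_map_lieConj_iff]
  rfl

theorem map_lieConj_refl (g : LieSubalgebra K (Module.End K V₁)) :
    g.map (LinearEquiv.refl K V₁).lieConj.toLieHom = g := by
  ext T
  simp only [mem_map_lieConj_iff]
  rfl

/-- Splitting the second factor `W` of `V₁ ⊗ W` as `V₂ ⊗ V₃` and joining `V₂` to `V₁`. -/
theorem tensorSum_map_regroup {K V₁ V₂ V₃ W U : Type*} [Field K] [AddCommGroup V₁] [Module K V₁]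
    [AddCommGroup V₂] [Module K V₂] [AddCommGroup V₃] [Module K V₃] [AddCommGroup W] [Module K W]
    [AddCommGroup U] [Module K U] (g₁ : LieSubalgebra K (Module.End K V₁))
    (g₂ : LieSubalgebra K (Module.End K V₂)) (g₃ : LieSubalgebra K (Module.End K V₃))
    (g : LieSubalgebra K (Module.End K W)) (e : W ≃ₗ[K] V₂ ⊗[K] V₃) (f : V₁ ⊗[K] V₂ ≃ₗ[K] U)
    (he : g.map e.lieConj.toLieHom = tensorSum g₂ g₃) :
    (tensorSum g₁ g).map (((TensorProduct.congr (LinearEquiv.refl K V₁) e).trans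
      (TensorProduct.assoc K V₁ V₂ V₃).symm).trans
        (TensorProduct.congr f (LinearEquiv.refl K V₃))).lieConj.toLieHom
      = tensorSum ((tensorSum g₁ g₂).map f.lieConj.toLieHom) g₃ := by
  rw [map_lieConj_trans, map_lieConj_trans, tensorSum_map_congr, map_lieConj_refl, he,
    tensorSum_map_assoc_symm, tensorSum_map_congr, map_lieConj_refl]

end TensorSum

/-! ### Normal forms, and `sl(2) ⊕ sl(2) = so(4)` -/

section NormalForms

/-- The tensor product `(x ⊗ y, z ⊗ w) ↦ β(x, z) s(y, w)` of two bilinear forms. -/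
def tensorForm {K M N : Type*} [Field K] [AddCommGroup M] [Module K M] [AddCommGroup N]
    [Module K N] (β : BilinForm K M) (s : BilinForm K N) : BilinForm K (M ⊗[K] N) :=
  TensorProduct.lift (LinearMap.mk₂ K
    (fun x y => LinearMap.mul' K K ∘ₗ TensorProduct.map (β x) (s y))
    (by intro x x' y; ext; simp [add_mul])
    (by intro c x y; ext; simp [mul_assoc])
    (by intro x y y'; ext; simp [mul_add])
    (by intro c x y; ext; simp [mul_left_comm]))

@[simp]
theorem tensorForm_tmul {K M N : Type*} [Field K] [AddCommGroup M] [Module K M] [AddCommGroup N]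
    [Module K N] (β : BilinForm K M) (s : BilinForm K N) (x z : M) (y w : N) :
    tensorForm β s (x ⊗ₜ y) (z ⊗ₜ w) = β x z * s y w := by
  simp [tensorForm]

/-- Over `ℂ` every nondegenerate symmetric bilinear form has an orthonormal basis. -/
theorem exists_equiv_dotForm {M : Type*} [AddCommGroup M] [Module ℂ M] [FiniteDimensional ℂ M]
    (s : BilinForm ℂ M) (hs : s.IsSymm) (hn : s.Nondegenerate) {n : ℕ}
    (hM : Module.finrank ℂ M = n) :
    ∃ e : M ≃ₗ[ℂ] (Fin n → ℂ), ∀ x y, dotForm n (e x) (e y) = s x y := by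
  subst hM
  have hassoc : QuadraticMap.associated (R := ℂ) s.toQuadraticMap = s :=
    QuadraticMap.associated_left_inverse ℂ hs.eq
  obtain ⟨e⟩ := QuadraticForm.equivalent_weightedSumSquares_of_isAlgClosed s.toQuadraticMap
    (by rw [hassoc]; exact hn.1)
  have he : ∀ x, dotForm _ (e.toLinearEquiv x) (e.toLinearEquiv x) = s x x := by
    intro x
    have := e.map_app x
    rw [QuadraticMap.weightedSumSquares_apply] at this
    simpa only [Pi.one_apply, one_smul] using! this
  refine ⟨e.toLinearEquiv, fun x y => ?_⟩
  have h1 := he (x + y)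
  simp only [map_add, LinearMap.add_apply, he] at h1
  have h2 : dotForm _ (e.toLinearEquiv y) (e.toLinearEquiv x)
      = dotForm _ (e.toLinearEquiv x) (e.toLinearEquiv y) := by simp [dotProduct_comm]
  have h3 : s y x = s x y := hs.eq y x
  rw [h2, h3] at h1
  linear_combination h1 / 2

/-- Over `ℂ` the area form is the only nondegenerate alternating form on a plane. -/
theorem exists_equiv_areaForm {M : Type*} [AddCommGroup M] [Module ℂ M] [FiniteDimensional ℂ M]
    (b : BilinForm ℂ M) (hb : b.IsAlt) (hn : b.Nondegenerate)
    (hM : Module.finrank ℂ M = 2) :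
    ∃ e : M ≃ₗ[ℂ] (Fin 2 → ℂ), ∀ x y, areaForm (e x) (e y) = b x y := by
  have : Nontrivial M := Module.nontrivial_of_finrank_pos (R := ℂ) (by omega)
  obtain ⟨x, hx⟩ := exists_ne (0 : M)
  obtain ⟨y, hy⟩ : ∃ y, b x y ≠ 0 := by
    by_contra! h
    exact hx (hn.1 x h)
  have hbxx := hb.self_eq_zero
  have hneg : b y x = -b x y := by rw [LinearMap.IsAlt.neg hb]
  have hli : LinearIndependent ℂ ![x, (b x y)⁻¹ • y] := by
    rw [LinearIndependent.pair_iff]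
    intro c d h
    have h1 := congrArg (b x) h
    have h2 := congrArg (b y) h
    simp [hbxx, hneg, hy] at h1 h2
    exact ⟨h2, h1⟩
  let B := basisOfLinearIndependentOfCardEqFinrank hli (by simp [hM])
  refine ⟨B.equivFun, ?_⟩
  have hB0 : B 0 = x := by simp [B]
  have hB1 : B 1 = (b x y)⁻¹ • y := by simp [B]
  have hL : ∀ i, B.equivFun.toLinearMap (B i) = Pi.single i 1 := by
    intro i; ext j; simp [Pi.single_apply, eq_comm]
  have : areaForm.compl₁₂ B.equivFun.toLinearMap B.equivFun.toLinearMap = b := by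
    refine B.ext fun i => B.ext fun j => ?_
    rw [LinearMap.compl₁₂_apply, hL, hL]
    fin_cases i <;> fin_cases j <;> simp [hB0, hB1, hbxx, hneg, hy]
  intro u v
  exact LinearMap.congr_fun₂ this u v

/-- Transport of skew-adjoint algebras along an isometry. -/
theorem map_skewAdjoint {K M N : Type*} [Field K] [AddCommGroup M] [Module K M] [AddCommGroup N]
    [Module K N] {B : BilinForm K M} {B' : BilinForm K N} (e : M ≃ₗ[K] N)
    (he : ∀ x y, B' (e x) (e y) = B x y) :
    (skewAdjointLieSubalgebra B).map e.lieConj.toLieHom = skewAdjointLieSubalgebra B' := by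
  ext T
  rw [mem_map_lieConj_iff, mem_skewAdjoint_iff, mem_skewAdjoint_iff]
  simp only [← he, LinearEquiv.conj_apply_apply, LinearEquiv.apply_symm_apply,
    LinearEquiv.symm_symm]
  constructor
  · intro h x y
    simpa using h (e.symm x) (e.symm y)
  · intro h x y
    exact h _ _

/-- `sl(2) ⊕ sl(2)` acting on `ℂ² ⊗ ℂ²` is `so(4)` acting on `ℂ⁴`. -/
theorem exists_equiv_so_four : ∃ f : (Fin 2 → ℂ) ⊗[ℂ] (Fin 2 → ℂ) ≃ₗ[ℂ] (Fin 4 → ℂ),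
    (tensorSum sl2 sl2).map f.lieConj.toLieHom = so 4 := by
  set q : BilinForm ℂ ((Fin 2 → ℂ) ⊗[ℂ] (Fin 2 → ℂ)) := tensorForm areaForm areaForm
  have hq : ∀ x y z w, q (x ⊗ₜ y) (z ⊗ₜ w) = areaForm x z * areaForm y w :=
    fun x y z w => tensorForm_tmul ..
  have hsymm : q.IsSymm := by
    have : q = LinearMap.flip q := by
      refine TensorProduct.ext' fun x y => TensorProduct.ext' fun z w => ?_
      rw [LinearMap.flip_apply, hq, hq]
      simp only [areaForm_apply]
      ring
    exact ⟨fun x y => LinearMap.congr_fun₂ this x y⟩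
  let bs := (Pi.basisFun ℂ (Fin 2)).tensorProduct (Pi.basisFun ℂ (Fin 2))
  have hnon : q.Nondegenerate := by
    refine nondegenerate_of_isRefl hsymm.isRefl fun t ht => ?_
    have h1 : ∀ k l, q (∑ i, bs.repr t i • bs i) (Pi.single k 1 ⊗ₜ Pi.single l 1) = 0 := by
      intro k l; rw [bs.sum_repr t]; exact ht _
    rw [bs.ext_elem_iff]
    generalize bs.repr t = c at h1
    have h00 := h1 0 0
    have h01 := h1 0 1
    have h10 := h1 1 0
    have h11 := h1 1 1
    simp [bs, Fintype.sum_prod_type, hq] at h00 h01 h10 h11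
    rintro ⟨k, l⟩
    fin_cases k <;> fin_cases l <;> simp [*]
  obtain ⟨f, hf⟩ := exists_equiv_dotForm (n := 4) q hsymm hnon (by simp)
  refine ⟨f, le_antisymm ?_ (so_le_of_wedge_mem _ fun a v => ?_)⟩
  · rw [← skewAdjoint_dotForm, ← map_skewAdjoint f hf]
    refine Submodule.map_mono (p := (tensorSum sl2 sl2).toSubmodule)
      (p' := (skewAdjointLieSubalgebra q).toSubmodule) ?_
    rintro _ ⟨A, hA, B, hB, rfl⟩
    have hA' := (mem_skewAdjoint_iff _ _).1 (sl2_le_skewAdjoint hA)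
    have hB' := (mem_skewAdjoint_iff _ _).1 (sl2_le_skewAdjoint hB)
    refine (mem_skewAdjoint_iff q _).2 ?_
    have : q.compl₁₂ (A.rTensor _ + B.lTensor _) LinearMap.id
        = -q.compl₁₂ LinearMap.id (A.rTensor _ + B.lTensor _) := by
      refine TensorProduct.ext' fun x y => TensorProduct.ext' fun z w => ?_
      simp only [LinearMap.compl₁₂_apply, LinearMap.add_apply, LinearMap.rTensor_tmul,
        LinearMap.lTensor_tmul, LinearMap.id_apply, map_add, LinearMap.neg_apply, hq, hA', hB']
      ring
    intro x y
    simpa using LinearMap.congr_fun₂ this x y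
  · rw [mem_map_lieConj_iff]
    have hconj : f.symm.conj (wedge (dotForm 4) a v) = wedge q (f.symm a) (f.symm v) := by
      refine LinearMap.ext fun u => ?_
      simp [LinearEquiv.conj_apply_apply, ← hf]
    rw [hconj]
    generalize f.symm a = s
    generalize f.symm v = t
    induction s with
    | zero => simp
    | add s₁ s₂ h₁ h₂ => rw [map_add, LinearMap.add_apply]; exact add_mem h₁ h₂
    | tmul x y =>
      induction t with
      | zero => simp
      | add s₁ s₂ h₁ h₂ => rw [map_add]; exact add_mem h₁ h₂
      | tmul z w =>
        -- `(x ⊗ y) ∧ (z ⊗ w)` is half of `ω(y, w) (x ⊙ z) ⊗ 1 + 1 ⊗ ω(x, z) (y ⊙ w)`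
        set A : Module.End ℂ (Fin 2 → ℂ) := (areaForm y w / 2) •
          ((areaForm x).smulRight z + (areaForm z).smulRight x) with hA
        set B : Module.End ℂ (Fin 2 → ℂ) := (areaForm x z / 2) •
          ((areaForm y).smulRight w + (areaForm w).smulRight y) with hB
        refine ⟨A, ?_, B, ?_, ?_⟩
        · rw [mem_sl2_iff]; simp [hA]; ring
        · rw [mem_sl2_iff]; simp [hB]; ring
        · refine TensorProduct.ext' fun p r => bs.ext_elem fun kl => ?_
          obtain ⟨k, l⟩ := kl
          fin_cases k <;> fin_cases l <;> simp [bs, hA, hB, hq] <;> ring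

end NormalForms

/-! ### Irreducible Lie algebras of endomorphisms -/

section Irreducible

variable {K M N : Type*} [Field K] [AddCommGroup M] [Module K M] [AddCommGroup N] [Module K N]

/-- The only subspaces of `M` invariant under `g ⊆ gl(M)` are `0` and `M`. Unlike
`LieModule.IsIrreducible`, this allows `M = 0`. -/
def ActsIrreducibly (g : LieSubalgebra K (Module.End K M)) : Prop :=
  ∀ W : Submodule K M, (∀ A ∈ g, ∀ w ∈ W, A w ∈ W) → W = ⊥ ∨ W = ⊤

theorem ActsIrreducibly.of_isIrreducible {g : LieSubalgebra K (Module.End K M)}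
    (h : LieModule.IsIrreducible K g M) : ActsIrreducibly g := by
  intro W hW
  let W' : LieSubmodule K g M := { W with lie_mem := fun {x m} hm => hW x x.2 m hm }
  rcases eq_bot_or_eq_top W' with h | h
  · left; simpa [W'] using congrArg LieSubmodule.toSubmodule h
  · right; simpa [W'] using congrArg LieSubmodule.toSubmodule h

theorem ActsIrreducibly.isIrreducible [Nontrivial M] {g : LieSubalgebra K (Module.End K M)}
    (h : ActsIrreducibly g) : LieModule.IsIrreducible K g M := by
  refine LieModule.IsIrreducible.mk fun W hW => ?_
  rcases h W.toSubmodule (fun A hA w hw => W.lie_mem (x := (⟨A, hA⟩ : g)) hw) with h | h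
  · exact absurd ((LieSubmodule.toSubmodule_eq_bot W).1 h) hW
  · simpa using h

theorem ActsIrreducibly.map {g : LieSubalgebra K (Module.End K M)} (h : ActsIrreducibly g)
    (e : M ≃ₗ[K] N) : ActsIrreducibly (g.map e.lieConj.toLieHom) := by
  intro W hW
  rcases h (W.comap e.toLinearMap) (fun A hA w hw => by
    have := hW (e.conj A) ⟨A, hA, rfl⟩ (e w) hw
    simpa [LinearEquiv.conj_apply_apply] using this) with h | h
  · left
    rw [Submodule.eq_bot_iff] at h ⊢
    intro x hx
    simpa using h (e.symm x) (by simpa using hx)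
  · right
    rw [Submodule.eq_top_iff'] at h ⊢
    intro x
    simpa using h (e.symm x)

/-- If `W` is invariant under the second summand, then `M ⊗ W` is invariant under the sum. -/
theorem ActsIrreducibly.of_tensorSum [Nontrivial M] {g₁ : LieSubalgebra K (Module.End K M)}
    {g₂ : LieSubalgebra K (Module.End K N)} (h : ActsIrreducibly (tensorSum g₁ g₂)) :
    ActsIrreducibly g₂ := by
  intro W hW
  obtain ⟨p, hp⟩ := exists_ne (0 : M)
  obtain ⟨φ, hφ⟩ := Module.Projective.exists_dual_ne_zero K hp
  let c : M ⊗[K] N →ₗ[K] N := (TensorProduct.lid K N).toLinearMap ∘ₗ φ.rTensor N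
  have hc : ∀ x y, c (x ⊗ₜ y) = φ x • y := fun x y => by simp [c]
  have hrange : ∀ t ∈ LinearMap.range (W.subtype.lTensor M), c t ∈ W := by
    rintro _ ⟨t, rfl⟩
    induction t with
    | zero => simp
    | add x y hx hy => rw [map_add, map_add]; exact add_mem hx hy
    | tmul x y => rw [LinearMap.lTensor_tmul, hc]; exact W.smul_mem _ y.2
  rcases h (LinearMap.range (W.subtype.lTensor M)) (by
    rintro _ ⟨A, hA, B, hB, rfl⟩ _ ⟨t, rfl⟩
    induction t with
    | zero => simp
    | add x y hx hy => rw [map_add, map_add]; exact add_mem hx hy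
    | tmul x y =>
      refine ⟨A x ⊗ₜ y + x ⊗ₜ ⟨B y, hW B hB y y.2⟩, by simp⟩) with h | h
  · left
    rw [Submodule.eq_bot_iff] at h ⊢
    intro w hw
    have h1 := h _ ⟨p ⊗ₜ ⟨w, hw⟩, rfl⟩
    have h2 := congrArg c h1
    rw [LinearMap.lTensor_tmul, hc, map_zero] at h2
    exact (smul_eq_zero.1 h2).resolve_left hφ
  · right
    rw [Submodule.eq_top_iff'] at h ⊢
    intro w
    have h1 := hrange _ (h (p ⊗ₜ w))
    rw [hc] at h1
    simpa [hφ] using W.smul_mem (φ p)⁻¹ h1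

end Irreducible

/-! ### The symplectic form on the second factor -/

section SymplecticForm

variable {V₂ : Type*} [AddCommGroup V₂] [Module ℂ V₂]

theorem rTensor_add_lTensor_injective [Nontrivial V₂] {A : Module.End ℂ (Fin 2 → ℂ)}
    (hA : A ∈ sl2) {B : Module.End ℂ V₂}
    (h : A.rTensor V₂ + B.lTensor (Fin 2 → ℂ) = 0) : A = 0 ∧ B = 0 := by
  rw [mem_sl2_iff] at hA
  have key : ∀ i j v, A (Pi.single i 1) j • v + (Pi.single i (1 : ℂ) : Fin 2 → ℂ) j • B v = 0 := by
    intro i j v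
    have h1 := LinearMap.congr_fun h (Pi.single i 1 ⊗ₜ v)
    have h2 := congrArg ((TensorProduct.lid ℂ V₂).toLinearMap ∘ₗ
      (LinearMap.proj j : (Fin 2 → ℂ) →ₗ[ℂ] ℂ).rTensor V₂) h1
    simpa using h2
  obtain ⟨v, hv⟩ := exists_ne (0 : V₂)
  have h01 : A (Pi.single 0 1) 1 = 0 := by simpa [hv] using key 0 1 v
  have h10 : A (Pi.single 1 1) 0 = 0 := by simpa [hv] using key 1 0 v
  have hB : ∀ v, B v = 0 := by
    intro v
    have h0 := key 0 0 v
    have h1 := key 1 1 v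
    simp only [Pi.single_eq_same, one_smul] at h0 h1
    have : (2 : ℂ) • B v = 0 := by
      calc (2 : ℂ) • B v = (A (Pi.single 0 1) 0 • v + B v) + (A (Pi.single 1 1) 1 • v + B v)
            - (A (Pi.single 0 1) 0 + A (Pi.single 1 1) 1) • v := by module
        _ = 0 := by rw [h0, h1, hA]; simp
    simpa using this
  have h00 : A (Pi.single 0 1) 0 = 0 := by simpa [hv, hB] using key 0 0 v
  have h11 : A (Pi.single 1 1) 1 = 0 := by simpa [hv, hB] using key 1 1 v
  refine ⟨?_, LinearMap.ext hB⟩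
  refine LinearMap.pi_ext' fun i => LinearMap.ext_ring ?_
  ext j
  fin_cases i <;> fin_cases j <;> simp [*]

/-- The decomposition `sl(2) ⊕ g₂ = sl(2) × g₂` of the underlying vector spaces. -/
noncomputable def splitEquiv [Nontrivial V₂] (g₂ : LieSubalgebra ℂ (Module.End ℂ V₂)) :
    (sl2 × g₂) ≃ₗ[ℂ] tensorSum sl2 g₂ :=
  LinearEquiv.ofBijective
    { toFun := fun p => ⟨(p.1 : Module.End ℂ (Fin 2 → ℂ)).rTensor V₂
        + (p.2 : Module.End ℂ V₂).lTensor (Fin 2 → ℂ), p.1, p.1.2, p.2, p.2.2, rfl⟩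
      map_add' := by
        intro p q
        ext1
        simp only [Prod.fst_add, Prod.snd_add, AddMemClass.coe_add, LinearMap.rTensor_add,
          LinearMap.lTensor_add]
        abel
      map_smul' := by
        intro c p
        ext1
        simp only [Prod.smul_fst, Prod.smul_snd, SetLike.val_smul, LinearMap.rTensor_smul,
          LinearMap.lTensor_smul, smul_add, RingHom.id_apply] }
    (by
      constructor
      · rw [← LinearMap.ker_eq_bot, Submodule.eq_bot_iff]
        rintro ⟨A, B⟩ h
        have := rTensor_add_lTensor_injective A.2 (congrArg Subtype.val (LinearMap.mem_ker.1 h))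
        ext1 <;> ext1
        exacts [this.1, this.2]
      · rintro ⟨_, A, hA, B, hB, rfl⟩
        exact ⟨(⟨A, hA⟩, ⟨B, hB⟩), rfl⟩)

theorem coe_splitEquiv_symm [Nontrivial V₂] (g₂ : LieSubalgebra ℂ (Module.End ℂ V₂))
    (T : tensorSum sl2 g₂) : (T : Module.End ℂ ((Fin 2 → ℂ) ⊗[ℂ] V₂)) =
      ((((splitEquiv g₂).symm T).1 : sl2) : Module.End ℂ (Fin 2 → ℂ)).rTensor V₂
        + ((((splitEquiv g₂).symm T).2 : g₂) : Module.End ℂ V₂).lTensor (Fin 2 → ℂ) := by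
  conv_lhs => rw [← (splitEquiv g₂).apply_symm_apply T]
  rfl

/-- A symmetric form on `ℂ² ⊗ V₂` that is invariant under `sl(2) ⊕ g₂` is the product of the area
form and a symplectic form on `V₂` that is invariant under `g₂`. -/
theorem exists_symplectic {g₂ : LieSubalgebra ℂ (Module.End ℂ V₂)}
    {h : BilinForm ℂ ((Fin 2 → ℂ) ⊗[ℂ] V₂)} (hs : h.IsSymm) (hn : h.Nondegenerate)
    (hle : tensorSum sl2 g₂ ≤ skewAdjointLieSubalgebra h) :
    ∃ σ : BilinForm ℂ V₂, σ.IsAlt ∧ σ.Nondegenerate ∧ g₂ ≤ skewAdjointLieSubalgebra σ ∧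
      ∀ x y v w, h (x ⊗ₜ v) (y ⊗ₜ w) = areaForm x y * σ v w := by
  have hsl : ∀ A ∈ sl2, ∀ x y v w, h (A x ⊗ₜ v) (y ⊗ₜ w) = - h (x ⊗ₜ v) (A y ⊗ₜ w) := by
    intro A hA x y v w
    have := (mem_skewAdjoint_iff h _).1 (hle ⟨A, hA, 0, g₂.zero_mem, rfl⟩) (x ⊗ₜ v) (y ⊗ₜ w)
    simpa using this
  have hg : ∀ B ∈ g₂, ∀ x y v w, h (x ⊗ₜ B v) (y ⊗ₜ w) = - h (x ⊗ₜ v) (y ⊗ₜ B w) := by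
    intro B hB x y v w
    have := (mem_skewAdjoint_iff h _).1 (hle ⟨0, sl2.zero_mem, B, hB, rfl⟩) (x ⊗ₜ v) (y ⊗ₜ w)
    simpa using this
  set e : Fin 2 → (Fin 2 → ℂ) := fun i => Pi.single i 1 with he
  let σ : BilinForm ℂ V₂ :=
    h.compl₁₂ (TensorProduct.mk ℂ _ V₂ (e 0)) (TensorProduct.mk ℂ _ V₂ (e 1))
  have hσ : ∀ v w, σ v w = h (e 0 ⊗ₜ v) (e 1 ⊗ₜ w) := fun v w => rfl
  -- invariance under the raising operator and under its transpose
  have hR : (areaForm (e 0)).smulRight (e 0) ∈ sl2 := by rw [mem_sl2_iff]; simp [he]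
  have hL : (areaForm (e 1)).smulRight (e 1) ∈ sl2 := by rw [mem_sl2_iff]; simp [he]
  have h00 : ∀ v w, h (e 0 ⊗ₜ v) (e 0 ⊗ₜ w) = 0 := by
    intro v w
    simpa [he] using hsl _ hR (e 0) (e 1) v w
  have h11 : ∀ v w, h (e 1 ⊗ₜ v) (e 1 ⊗ₜ w) = 0 := by
    intro v w
    simpa [he, TensorProduct.neg_tmul] using (hsl _ hL (e 1) (e 0) v w).symm
  have h10 : ∀ v w, h (e 1 ⊗ₜ v) (e 0 ⊗ₜ w) = -σ v w := by
    intro v w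
    have := hsl _ hR (e 1) (e 1) v w
    simp [he] at this
    rw [hσ]
    simp only [he]
    rw [this, neg_neg]
  have hprod : ∀ x y v w, h (x ⊗ₜ v) (y ⊗ₜ w) = areaForm x y * σ v w := by
    intro x y v w
    have hx : ∀ x : Fin 2 → ℂ, x = x 0 • e 0 + x 1 • e 1 := by
      intro x; ext i; fin_cases i <;> simp [he]
    conv_lhs => rw [hx x, hx y]
    simp only [TensorProduct.add_tmul, ← TensorProduct.smul_tmul', map_add, map_smul,
      LinearMap.add_apply, LinearMap.smul_apply, h00, h11, h10, ← hσ, areaForm_apply, smul_eq_mul]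
    ring
  have halt : σ.IsAlt := by
    intro v
    have h1 := hs.eq (e 0 ⊗ₜ v) (e 1 ⊗ₜ v)
    rw [h10, ← hσ] at h1
    have : σ v v + σ v v = 0 := by linear_combination h1
    simpa using this
  refine ⟨σ, halt, nondegenerate_of_isRefl halt.isRefl fun v hv => ?_, ?_, hprod⟩
  · have h1 : e 0 ⊗ₜ[ℂ] v = 0 := by
      refine hn.1 _ fun t => ?_
      induction t with
      | zero => simp
      | add x y hx hy => rw [map_add, hx, hy, add_zero]
      | tmul x w => rw [hprod, hv, mul_zero]
    have h2 := congrArg ((TensorProduct.lid ℂ V₂).toLinearMap ∘ₗ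
      (LinearMap.proj 0 : (Fin 2 → ℂ) →ₗ[ℂ] ℂ).rTensor V₂) h1
    simpa [he] using h2
  · intro B hB
    rw [mem_skewAdjoint_iff]
    intro v w
    exact hg B hB _ _ v w

end SymplecticForm

/-! ### Nondegenerate forms -/

section Duality

variable {K M : Type*} [Field K] [AddCommGroup M] [Module K M] [FiniteDimensional K M]

theorem exists_apply_eq_of_nondegenerate {B : BilinForm K M} (hB : B.Nondegenerate)
    (f : Module.Dual K M) : ∃ a, ∀ u, B a u = f u :=
  ⟨(B.toDual hB).symm f, fun u => B.apply_toDual_symm_apply f u⟩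

theorem exists_orthogonal_of_notMem {B : BilinForm K M} (hB : B.Nondegenerate)
    {U : Submodule K M} {v : M} (hv : v ∉ U) : ∃ w, B w v ≠ 0 ∧ ∀ u ∈ U, B w u = 0 := by
  obtain ⟨f, hf, hU⟩ := Submodule.exists_le_ker_of_notMem hv
  obtain ⟨w, hw⟩ := exists_apply_eq_of_nondegenerate hB f
  exact ⟨w, by rwa [hw], fun u hu => by rw [hw]; exact hU hu⟩

omit [FiniteDimensional K M] in
theorem exists_notMem_span_pair (hM : 3 ≤ Module.finrank K M) (x y : M) :
    ∃ a, a ∉ Submodule.span K {x, y} := by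
  by_contra! h
  have htop : Submodule.span K {x, y} = ⊤ := Submodule.eq_top_iff'.2 h
  have h1 : Module.finrank K (Submodule.span K ({x, y} : Set M)) ≤ 2 := by
    classical
    have := finrank_span_finset_le_card (R := K) ({x, y} : Finset M)
    have h2 : ({x, y} : Finset M).card ≤ 2 := Finset.card_le_two
    simp only [Finset.coe_insert, Finset.coe_singleton] at this
    exact this.trans h2
  rw [htop, finrank_top] at h1
  omega

/-- In dimension at least three, wedging a `1`-form with a symplectic form is injective. -/
theorem eq_zero_of_cyclic_sum_eq_zero {σ : BilinForm K M} (hσ : σ.IsAlt) (hn : σ.Nondegenerate)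
    (hM : 3 ≤ Module.finrank K M) {α : M →ₗ[K] K}
    (h : ∀ u v w, α u * σ v w + α v * σ w u + α w * σ u v = 0) : α = 0 := by
  ext u
  by_cases hu : u = 0
  · simp [hu]
  obtain ⟨v, hv, huv⟩ : ∃ v, σ u v = 0 ∧ v ∉ Submodule.span K {u} := by
    by_contra! hcon
    have hle : LinearMap.ker (σ u) ≤ Submodule.span K {u} := fun v hv => hcon v hv
    have h1 := Submodule.finrank_mono hle
    have h2 := finrank_span_singleton (K := K) hu
    have h3 := LinearMap.finrank_range_add_finrank_ker (σ u)
    have h4 := (LinearMap.range (σ u)).finrank_le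
    rw [Module.finrank_self] at h4
    omega
  obtain ⟨w, hwv, hwu⟩ := exists_orthogonal_of_notMem hn huv
  have hwu' := hwu u (Submodule.mem_span_singleton_self u)
  have := h u v w
  rw [hwu', hv, ← hσ.neg_eq w v] at this
  simpa [hwv] using this

end Duality

/-! ### Curvature pairs -/

section CurvaturePairs

variable {F : Type*} [AddCommGroup F] [Module ℂ F]

/-- A linear map `A : F → g` and a vector `a ∈ F` with
`A(u) v - A(v) u = σ(a, v) u - σ(a, u) v + 2 σ(u, v) a`. For `g = sp(F, σ)` the elements
`A(u) = u ⊙ a` form such a pair; in general these pairs are what a weak curvature map of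
`sl(2) ⊕ g` on `ℂ² ⊗ F` restricts to. -/
def IsCurvaturePair (σ : BilinForm ℂ F) {g : LieSubalgebra ℂ (Module.End ℂ F)}
    (A : F →ₗ[ℂ] g) (a : F) : Prop :=
  ∀ u v, (A u : Module.End ℂ F) v - (A v : Module.End ℂ F) u
    = σ a v • u - σ a u • v + (2 * σ u v) • a

/-- The weak curvature identity, evaluated on decomposable tensors. -/
theorem curvature_apply_tmul [Nontrivial F] {g : LieSubalgebra ℂ (Module.End ℂ F)}
    {h : BilinForm ℂ ((Fin 2 → ℂ) ⊗[ℂ] F)} {σ : BilinForm ℂ F}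
    (hprod : ∀ x y v w, h (x ⊗ₜ v) (y ⊗ₜ w) = areaForm x y * σ v w)
    {Q : (Fin 2 → ℂ) ⊗[ℂ] F →ₗ[ℂ] tensorSum sl2 g} (hQ : Q ∈ curvatureSpace h (tensorSum sl2 g))
    {Q₁ : (Fin 2 → ℂ) ⊗[ℂ] F →ₗ[ℂ] sl2} (hQ₁ : ∀ t, Q₁ t = ((splitEquiv g).symm (Q t)).1)
    {Q₂ : (Fin 2 → ℂ) ⊗[ℂ] F →ₗ[ℂ] g} (hQ₂ : ∀ t, Q₂ t = ((splitEquiv g).symm (Q t)).2)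
    (x y z : Fin 2 → ℂ) (u v w : F) :
    (areaForm ((Q₁ (x ⊗ₜ u) : Module.End ℂ (Fin 2 → ℂ)) y) z * σ v w
        + areaForm y z * σ ((Q₂ (x ⊗ₜ u) : Module.End ℂ F) v) w)
      + (areaForm ((Q₁ (y ⊗ₜ v) : Module.End ℂ (Fin 2 → ℂ)) z) x * σ w u
        + areaForm z x * σ ((Q₂ (y ⊗ₜ v) : Module.End ℂ F) w) u)
      + (areaForm ((Q₁ (z ⊗ₜ w) : Module.End ℂ (Fin 2 → ℂ)) x) y * σ u v
        + areaForm x y * σ ((Q₂ (z ⊗ₜ w) : Module.End ℂ F) u) v) = 0 := by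
  have key : ∀ (x y z : Fin 2 → ℂ) (u v w : F),
      h ((Q (x ⊗ₜ u) : Module.End ℂ ((Fin 2 → ℂ) ⊗[ℂ] F)) (y ⊗ₜ v)) (z ⊗ₜ w) =
      areaForm ((Q₁ (x ⊗ₜ u) : Module.End ℂ (Fin 2 → ℂ)) y) z * σ v w
        + areaForm y z * σ ((Q₂ (x ⊗ₜ u) : Module.End ℂ F) v) w := by
    intro x y z u v w
    rw [coe_splitEquiv_symm, ← hQ₁, ← hQ₂, LinearMap.add_apply, LinearMap.rTensor_tmul,
      LinearMap.lTensor_tmul, map_add, LinearMap.add_apply, hprod, hprod]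
  rw [← key, ← key, ← key]
  exact hQ _ _ _

variable [FiniteDimensional ℂ F] {σ : BilinForm ℂ F} {g : LieSubalgebra ℂ (Module.End ℂ F)}

/-- The components of a weak curvature map along a symplectic basis `x, y` of `ℂ²`: the
`sl(2)`-part is determined by a single vector `a`, and the `g`-part then forms a curvature pair
with `a`. -/
theorem curvature_components (hσ : σ.IsAlt) (hn : σ.Nondegenerate)
    (hF : 3 ≤ Module.finrank ℂ F) {Q₁ : (Fin 2 → ℂ) ⊗[ℂ] F →ₗ[ℂ] sl2}
    {Q₂ : (Fin 2 → ℂ) ⊗[ℂ] F →ₗ[ℂ] g}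
    (hQ : ∀ (x y z : Fin 2 → ℂ) (u v w : F),
      (areaForm ((Q₁ (x ⊗ₜ u) : Module.End ℂ (Fin 2 → ℂ)) y) z * σ v w
        + areaForm y z * σ ((Q₂ (x ⊗ₜ u) : Module.End ℂ F) v) w)
      + (areaForm ((Q₁ (y ⊗ₜ v) : Module.End ℂ (Fin 2 → ℂ)) z) x * σ w u
        + areaForm z x * σ ((Q₂ (y ⊗ₜ v) : Module.End ℂ F) w) u)
      + (areaForm ((Q₁ (z ⊗ₜ w) : Module.End ℂ (Fin 2 → ℂ)) x) y * σ u v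
        + areaForm x y * σ ((Q₂ (z ⊗ₜ w) : Module.End ℂ F) u) v) = 0)
    (hg : g ≤ skewAdjointLieSubalgebra σ) {x y : Fin 2 → ℂ} (hxy : areaForm x y = 1) :
    (∀ u, areaForm ((Q₁ (x ⊗ₜ u) : Module.End ℂ (Fin 2 → ℂ)) x) x = 0) ∧
    (∀ u, 2 * areaForm ((Q₁ (x ⊗ₜ u) : Module.End ℂ (Fin 2 → ℂ)) x) y
      + areaForm ((Q₁ (y ⊗ₜ u) : Module.End ℂ (Fin 2 → ℂ)) x) x = 0) ∧
    ∃ (A : F →ₗ[ℂ] g) (a : F), IsCurvaturePair σ A a ∧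
      ∀ u, σ a u = areaForm ((Q₁ (x ⊗ₜ u) : Module.End ℂ (Fin 2 → ℂ)) x) y := by
  have hyx : areaForm y x = -1 := by
    rw [areaForm_apply] at hxy ⊢; linear_combination -hxy
  have hxx : areaForm x x = 0 := by rw [areaForm_apply]; ring
  have hsl : ∀ t, areaForm ((Q₁ t : Module.End ℂ (Fin 2 → ℂ)) y) x
      = areaForm ((Q₁ t : Module.End ℂ (Fin 2 → ℂ)) x) y := by
    intro t
    rw [(mem_skewAdjoint_iff _ _).1 (sl2_le_skewAdjoint (Q₁ t).2)]
    simp only [areaForm_apply]; ring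
  have hsk : ∀ t v w, σ ((Q₂ t : Module.End ℂ F) v) w = σ ((Q₂ t : Module.End ℂ F) w) v := by
    intro t v w
    rw [(mem_skewAdjoint_iff _ _).1 (hg (Q₂ t).2), hσ.neg_eq]
  -- a linear functional built from matrix entries of the `sl(2)`-part
  let entry (x y z : Fin 2 → ℂ) : F →ₗ[ℂ] ℂ :=
    (areaForm.flip z) ∘ₗ (LinearMap.applyₗ y) ∘ₗ sl2.toSubmodule.subtype ∘ₗ Q₁ ∘ₗ
      TensorProduct.mk ℂ (Fin 2 → ℂ) F x
  have hentry : ∀ x y z u,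
      entry x y z u = areaForm ((Q₁ (x ⊗ₜ u) : Module.End ℂ (Fin 2 → ℂ)) y) z :=
    fun _ _ _ _ => rfl
  have h1 : entry x x x = 0 := by
    refine eq_zero_of_cyclic_sum_eq_zero hσ hn hF fun u v w => ?_
    have := hQ x x x u v w
    rw [hxx] at this
    simp only [hentry]
    linear_combination this
  have hE := fun u v w => hQ x x y u v w
  simp only [hxx, hxy, hyx, hsl] at hE
  have h2 : 2 • entry x x y + entry y x x = 0 := by
    refine eq_zero_of_cyclic_sum_eq_zero hσ hn hF fun u v w => ?_
    simp only [LinearMap.add_apply, LinearMap.smul_apply, hentry, nsmul_eq_mul]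
    push_cast
    linear_combination hE u v w + hE v w u + hE w u v
  have h2' : ∀ u, 2 * areaForm ((Q₁ (x ⊗ₜ u) : Module.End ℂ (Fin 2 → ℂ)) x) y
      + areaForm ((Q₁ (y ⊗ₜ u) : Module.End ℂ (Fin 2 → ℂ)) x) x = 0 := by
    intro u
    simpa [hentry, -areaForm_apply] using LinearMap.congr_fun h2 u
  refine ⟨fun u => LinearMap.congr_fun h1 u, h2', ?_⟩
  obtain ⟨a, ha⟩ := exists_apply_eq_of_nondegenerate hn (entry x x y)
  refine ⟨Q₂ ∘ₗ TensorProduct.mk ℂ (Fin 2 → ℂ) F x, a, fun u v => ?_, ha⟩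
  rw [← sub_eq_zero]
  refine hn.1 _ fun w => ?_
  have hw := hE u v w
  have h2w := h2' w
  have hwu := hσ.neg_eq w u
  rw [hsk _ w u] at hw
  simp only [map_sub, map_add, map_smul, LinearMap.sub_apply, LinearMap.add_apply,
    LinearMap.smul_apply, smul_eq_mul, ha, hentry, LinearMap.comp_apply, TensorProduct.mk_apply]
  linear_combination hw - σ u v * h2w
    + areaForm ((Q₁ (x ⊗ₜ v) : Module.End ℂ (Fin 2 → ℂ)) x) y * hwu

theorem eq_zero_of_mem_sl2 {T : Module.End ℂ (Fin 2 → ℂ)} (hT : T ∈ sl2)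
    (h00 : areaForm (T (Pi.single 0 1)) (Pi.single 0 1) = 0)
    (h01 : areaForm (T (Pi.single 0 1)) (Pi.single 1 1) = 0)
    (h11 : areaForm (T (Pi.single 1 1)) (Pi.single 1 1) = 0) : T = 0 := by
  rw [mem_sl2_iff] at hT
  simp at h00 h01 h11
  refine LinearMap.pi_ext' fun i => LinearMap.ext_ring ?_
  ext j
  fin_cases i <;> fin_cases j <;> simp_all

/-- The weak-Berger property forces a curvature pair with nonzero vector: otherwise all weak
curvature maps would take values in `g`, and their values could not span `sl(2)`. -/
theorem exists_isCurvaturePair {h : BilinForm ℂ ((Fin 2 → ℂ) ⊗[ℂ] F)}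
    (hwb : IsWeakBerger h (tensorSum sl2 g)) (hσ : σ.IsAlt) (hn : σ.Nondegenerate)
    (hprod : ∀ x y v w, h (x ⊗ₜ v) (y ⊗ₜ w) = areaForm x y * σ v w)
    (hg : g ≤ skewAdjointLieSubalgebra σ) (hF : 3 ≤ Module.finrank ℂ F) :
    ∃ (A : F →ₗ[ℂ] g) (a : F), IsCurvaturePair σ A a ∧ a ≠ 0 := by
  have : Nontrivial F := Module.nontrivial_of_finrank_pos (R := ℂ) (by omega)
  by_contra! hcon
  have hzero : ∀ Q ∈ curvatureSpace h (tensorSum sl2 g), ∀ t,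
      ((splitEquiv g).symm (Q t)).1 = 0 := by
    intro Q hQ
    let Q₁ : (Fin 2 → ℂ) ⊗[ℂ] F →ₗ[ℂ] sl2 :=
      LinearMap.fst ℂ sl2 g ∘ₗ (splitEquiv g).symm.toLinearMap ∘ₗ Q
    let Q₂ : (Fin 2 → ℂ) ⊗[ℂ] F →ₗ[ℂ] g :=
      LinearMap.snd ℂ sl2 g ∘ₗ (splitEquiv g).symm.toLinearMap ∘ₗ Q
    have hcyc := curvature_apply_tmul hprod hQ (Q₁ := Q₁) (fun _ => rfl) (Q₂ := Q₂) (fun _ => rfl)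
    have hdiag : ∀ x y : Fin 2 → ℂ, areaForm x y = 1 →
        (∀ u, areaForm ((Q₁ (x ⊗ₜ u) : Module.End ℂ (Fin 2 → ℂ)) x) x = 0) ∧
        (∀ u, areaForm ((Q₁ (x ⊗ₜ u) : Module.End ℂ (Fin 2 → ℂ)) x) y = 0) ∧
        (∀ u, areaForm ((Q₁ (y ⊗ₜ u) : Module.End ℂ (Fin 2 → ℂ)) x) x = 0) := by
      intro x y hxy
      obtain ⟨h1, h2, A, a, hA, ha⟩ := curvature_components hσ hn hF hcyc hg hxy
      have h3 : ∀ u, areaForm ((Q₁ (x ⊗ₜ u) : Module.End ℂ (Fin 2 → ℂ)) x) y = 0 := by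
        intro u
        rw [← ha, hcon A a hA, map_zero, LinearMap.zero_apply]
      refine ⟨h1, h3, fun u => ?_⟩
      have := h2 u
      rwa [h3, mul_zero, zero_add] at this
    suffices hQ₁ : Q₁ = 0 from fun t => LinearMap.congr_fun hQ₁ t
    obtain ⟨d1, d2, d3⟩ := hdiag (Pi.single 0 1) (Pi.single 1 1) (by simp)
    obtain ⟨e1, e2, e3⟩ := hdiag (Pi.single 1 1) (-Pi.single 0 1) (by simp)
    refine TensorProduct.ext' fun x u => ?_
    have hx : x = x 0 • Pi.single 0 1 + x 1 • Pi.single 1 1 := by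
      ext i; fin_cases i <;> simp
    have h0 : Q₁ (Pi.single 0 1 ⊗ₜ u) = 0 := by
      refine Subtype.ext (eq_zero_of_mem_sl2 (Q₁ _).2 (d1 u) (d2 u) ?_)
      have := e3 u
      rw [TensorProduct.neg_tmul, map_neg] at this
      rwa [NegMemClass.coe_neg, LinearMap.neg_apply, map_neg, LinearMap.neg_apply, neg_eq_zero]
        at this
    have h1 : Q₁ (Pi.single 1 1 ⊗ₜ u) = 0 := by
      refine Subtype.ext (eq_zero_of_mem_sl2 (Q₁ _).2 (d3 u) ?_ (e1 u))
      have := e2 u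
      rw [map_neg, neg_eq_zero] at this
      rw [(mem_skewAdjoint_iff _ _).1 (sl2_le_skewAdjoint (Q₁ _).2), neg_eq_zero]
      rw [areaForm_apply] at this ⊢
      linear_combination -this
    rw [hx, TensorProduct.add_tmul, ← TensorProduct.smul_tmul', ← TensorProduct.smul_tmul', map_add,
      map_smul, map_smul, h0, h1]
    simp
  -- hence the `sl(2)`-part of every element vanishes
  have hall : ∀ T : tensorSum sl2 g, ((splitEquiv g).symm T).1 = 0 := by
    intro T
    have hT : T ∈ Submodule.span ℂ {A : tensorSum sl2 g |
        ∃ Q ∈ curvatureSpace h (tensorSum sl2 g), ∃ x, Q x = A} := by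
      rw [hwb.span_eq_top]; trivial
    induction hT using Submodule.span_induction with
    | mem _ h => obtain ⟨Q, hQ, x, rfl⟩ := h; exact hzero Q hQ x
    | zero => simp
    | add S T _ _ hS hT => rw [map_add, Prod.fst_add, hS, hT, add_zero]
    | smul c T _ hT => rw [map_smul, Prod.smul_fst, hT, smul_zero]
  have hR : (areaForm (Pi.single 0 1)).smulRight (Pi.single 0 1) ∈ sl2 := by
    rw [mem_sl2_iff]; simp
  have := hall (splitEquiv g (⟨_, hR⟩, 0))
  rw [LinearEquiv.symm_apply_apply] at this
  have h2 := congrArg (fun T : sl2 => (T : Module.End ℂ (Fin 2 → ℂ)) (Pi.single 1 1) 0) this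
  simp at h2

omit [FiniteDimensional ℂ F] in
theorem IsCurvaturePair.lie (hg : g ≤ skewAdjointLieSubalgebra σ) {A : F →ₗ[ℂ] g} {a : F}
    (h : IsCurvaturePair σ A a) (X : g) : IsCurvaturePair σ ⁅X, A⁆ ⁅X, a⁆ := by
  intro u v
  have hX := (mem_skewAdjoint_iff _ _).1 (hg X.2)
  have h1 := congrArg (X : Module.End ℂ F) (h u v)
  have h2 := h u ((X : Module.End ℂ F) v)
  have h3 := h ((X : Module.End ℂ F) u) v
  have e1 : ∀ u : F, ⁅X, u⁆ = (X : Module.End ℂ F) u := fun u => rfl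
  have e2 : ∀ u v : F, ((⁅X, A⁆ u : g) : Module.End ℂ F) v =
      (X : Module.End ℂ F) ((A u : Module.End ℂ F) v)
        - (A u : Module.End ℂ F) ((X : Module.End ℂ F) v)
        - (A ((X : Module.End ℂ F) u) : Module.End ℂ F) v := by
    intro u v
    rw [LieHom.lie_apply]
    rfl
  simp only [map_sub, map_add, map_smul] at h1
  rw [e2, e2, e1, hX, hX]
  have e3 : ∀ b c d e f k : F, b - c - d - (e - f - k) = (b - e) - (c - k) - (d - f) := by
    intros; abel
  rw [e3, h1, h2, h3, hX u v]
  module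

/-- The product of two Lie modules, with the componentwise action. -/
instance prodLieRingModule {L M N : Type*} [LieRing L] [AddCommGroup M] [AddCommGroup N]
    [LieRingModule L M] [LieRingModule L N] : LieRingModule L (M × N) where
  bracket x p := (⁅x, p.1⁆, ⁅x, p.2⁆)
  add_lie x y p := Prod.ext (add_lie x y p.1) (add_lie x y p.2)
  lie_add x p q := Prod.ext (lie_add x p.1 q.1) (lie_add x p.2 q.2)
  leibniz_lie x y p := Prod.ext (leibniz_lie x y p.1) (leibniz_lie x y p.2)

instance prodLieModule {R L M N : Type*} [CommRing R] [LieRing L] [LieAlgebra R L]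
    [AddCommGroup M] [AddCommGroup N] [Module R M] [Module R N] [LieRingModule L M]
    [LieRingModule L N] [LieModule R L M] [LieModule R L N] : LieModule R L (M × N) where
  smul_lie c x p := Prod.ext (smul_lie c x p.1) (smul_lie c x p.2)
  lie_smul c x p := Prod.ext (lie_smul c x p.1) (lie_smul c x p.2)

/-- The `g`-module of all curvature pairs. -/
def curvaturePairs (hg : g ≤ skewAdjointLieSubalgebra σ) :
    LieSubmodule ℂ g ((F →ₗ[ℂ] g) × F) where
  carrier := {p | IsCurvaturePair σ p.1 p.2}
  zero_mem' := fun u v => by simp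
  add_mem' := by
    rintro ⟨B, b⟩ ⟨C, c⟩ hB hC u v
    have := congrArg₂ (· + ·) (hB u v) (hC u v)
    simp only [Prod.mk_add_mk, LinearMap.add_apply, AddMemClass.coe_add, map_add] at this ⊢
    rw [add_sub_add_comm, this]
    module
  smul_mem' := by
    rintro c ⟨B, b⟩ hB u v
    have := congrArg (c • ·) (hB u v)
    simp only [Prod.smul_mk, LinearMap.smul_apply, SetLike.val_smul, map_smul] at this ⊢
    rw [← smul_sub, this]
    simp only [smul_eq_mul]
    module
  lie_mem := fun {X p} hp => IsCurvaturePair.lie hg hp X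

omit [FiniteDimensional ℂ F] in
/-- For an irreducible `g`, every vector is the vector of a curvature pair as soon as one nonzero
vector is. -/
theorem forall_exists_isCurvaturePair (hg : g ≤ skewAdjointLieSubalgebra σ)
    (hirr : ActsIrreducibly g) {A : F →ₗ[ℂ] g} {a : F} (h : IsCurvaturePair σ A a) (ha : a ≠ 0)
    (b : F) : ∃ B : F →ₗ[ℂ] g, IsCurvaturePair σ B b := by
  let W : Submodule ℂ F := (curvaturePairs hg).toSubmodule.map (LinearMap.snd ℂ (F →ₗ[ℂ] g) F)
  have hmem : ∀ b, b ∈ W ↔ ∃ B : F →ₗ[ℂ] g, IsCurvaturePair σ B b := by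
    intro b
    constructor
    · rintro ⟨⟨B, b⟩, hB, rfl⟩
      exact ⟨B, hB⟩
    · rintro ⟨B, hB⟩
      exact ⟨(B, b), hB, rfl⟩
  rcases hirr W (fun X hX w hw => by
    obtain ⟨B, hB⟩ := (hmem w).1 hw
    exact (hmem _).2 ⟨_, hB.lie hg ⟨X, hX⟩⟩) with hW | hW
  · exact absurd ((Submodule.mem_bot ℂ).1 (hW ▸ (hmem a).2 ⟨A, h⟩)) ha
  · exact (hmem b).1 (hW ▸ Submodule.mem_top)

end CurvaturePairs

open LieModule

/-! ### Semisimplicity -/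

section Semisimple

variable {F : Type*} [AddCommGroup F] [Module ℂ F] [FiniteDimensional ℂ F]
  {σ : BilinForm ℂ F} {g : LieSubalgebra ℂ (Module.End ℂ F)}

theorem trace_eq_zero_of_mem_skewAdjoint (hn : σ.Nondegenerate) {T : Module.End ℂ F}
    (hT : T ∈ skewAdjointLieSubalgebra σ) : LinearMap.trace ℂ F T = 0 := by
  rw [mem_skewAdjoint_iff] at hT
  have h1 : (σ.toDual hn).conj T = -Module.Dual.transpose (R := ℂ) T := by
    ext f x
    obtain ⟨y, rfl⟩ := (σ.toDual hn).surjective f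
    rw [LinearEquiv.conj_apply_apply, LinearEquiv.symm_apply_apply]
    exact hT y x
  have h2 := congrArg (LinearMap.trace ℂ _) h1
  rw [LinearMap.trace_conj', map_neg, LinearMap.trace_transpose'] at h2
  have : LinearMap.trace ℂ F T + LinearMap.trace ℂ F T = 0 := by linear_combination h2
  simpa using this

/-- An irreducible subalgebra of `so(F, σ)` or `sp(F, σ)` is semisimple. -/
theorem hasTrivialRadical_of_irreducible [Nontrivial F] (hn : σ.Nondegenerate)
    (hg : g ≤ skewAdjointLieSubalgebra σ) (hirr : ActsIrreducibly g) :
    LieAlgebra.HasTrivialRadical ℂ g := by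
  have := hirr.isIrreducible
  have : LieModule.IsFaithful ℂ g F := by infer_instance
  exact LieAlgebra.hasTrivialRadical_of_isIrreducible_of_isFaithful ℂ g F fun x =>
    trace_eq_zero_of_mem_skewAdjoint hn (hg x.2)

end Semisimple

/-! ### Curvature pairs and weights -/

section WeightSpaces

/-- Equivariant bilinear maps add weights. -/
theorem apply_mem_genWeightSpace {L M₁ M₂ M₃ : Type*} [LieRing L] [LieAlgebra ℂ L]
    [LieRing.IsNilpotent L] [AddCommGroup M₁] [Module ℂ M₁] [LieRingModule L M₁] [LieModule ℂ L M₁]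
    [AddCommGroup M₂] [Module ℂ M₂] [LieRingModule L M₂] [LieModule ℂ L M₂]
    [AddCommGroup M₃] [Module ℂ M₃] [LieRingModule L M₃] [LieModule ℂ L M₃]
    (f : M₁ →ₗ⁅ℂ,L⁆ M₂ →ₗ[ℂ] M₃) {χ₁ χ₂ : L → ℂ} {m₁ : M₁} {m₂ : M₂}
    (h₁ : m₁ ∈ genWeightSpace M₁ χ₁) (h₂ : m₂ ∈ genWeightSpace M₂ χ₂) :
    f m₁ m₂ ∈ genWeightSpace M₃ (χ₁ + χ₂) := by
  rw [genWeightSpace, LieSubmodule.mem_iInf] at h₁ h₂ ⊢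
  intro x
  refine LieModule.weight_vector_multiplication M₁ M₂ M₃
    (TensorProduct.LieModule.liftLie ℂ L M₁ M₂ M₃ f) (χ₁ x) (χ₂ x) x
    ⟨⟨m₁, h₁ x⟩ ⊗ₜ ⟨m₂, h₂ x⟩, ?_⟩
  simp

variable {F : Type*} [AddCommGroup F] [Module ℂ F] [FiniteDimensional ℂ F]
  {σ : BilinForm ℂ F} {g : LieSubalgebra ℂ (Module.End ℂ F)}
  (t : LieSubalgebra ℂ g) [t.IsCartanSubalgebra]

omit [FiniteDimensional ℂ F] in
theorem mem_weights_iff (μ : Module.Dual ℂ t) :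
    μ ∈ weights g t ↔ genWeightSpace F (μ : t → ℂ) ≠ ⊥ :=
  ⟨fun ⟨w, hw⟩ => hw ▸ w.genWeightSpace_ne_bot, fun h => ⟨⟨μ, h⟩, rfl⟩⟩

omit [FiniteDimensional ℂ F] in
theorem zero_mem_rootsWithZero : (0 : Module.Dual ℂ t) ∈ rootsWithZero g t := Or.inr rfl

omit [FiniteDimensional ℂ F] in
theorem genWeightSpace_eq_bot_of_notMem {β : Module.Dual ℂ t} (h : β ∉ rootsWithZero g t) :
    genWeightSpace g (β : t → ℂ) = ⊥ := by
  by_contra hne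
  refine h (Or.inl ⟨⟨β, hne⟩, fun h0 => ?_, rfl⟩)
  refine h (Or.inr ?_)
  ext x
  exact congrFun h0 x

theorem neg_mem_rootsWithZero [LieAlgebra.IsKilling ℂ g] {β : Module.Dual ℂ t}
    (h : β ∈ rootsWithZero g t) : -β ∈ rootsWithZero g t := by
  rcases h with ⟨w, hw, hβ⟩ | h
  · refine Or.inl ⟨-w, hw.neg, ?_⟩
    ext x
    simp [← hβ]
  · right
    simpa using h

omit [FiniteDimensional ℂ F] in
/-- Weight spaces whose weights do not add up to zero are orthogonal for an invariant form. -/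
theorem apply_eq_zero_of_mem_genWeightSpace (hg : g ≤ skewAdjointLieSubalgebra σ) {χ₁ χ₂ : t → ℂ}
    (hχ : χ₁ + χ₂ ≠ 0) {u v : F} (hu : u ∈ genWeightSpace F χ₁) (hv : v ∈ genWeightSpace F χ₂) :
    σ u v = 0 := by
  let φ : ℂ ≃ₗ[ℂ] TrivialLieModule ℂ t ℂ := (TrivialLieModule.equiv ℂ t ℂ).symm
  let f : F →ₗ⁅ℂ,t⁆ F →ₗ[ℂ] TrivialLieModule ℂ t ℂ :=
    { toLinearMap := σ.compr₂ φ.toLinearMap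
      map_lie' := by
        intro x u
        refine LinearMap.ext fun v => ?_
        have := (mem_skewAdjoint_iff _ _).1 (hg (x : g).2) u v
        rw [LieHom.lie_apply, trivial_lie_zero t (TrivialLieModule ℂ t ℂ), zero_sub]
        change φ (σ (((x : g) : Module.End ℂ F) u) v) = -φ (σ u (((x : g) : Module.End ℂ F) v))
        rw [this, map_neg] }
  have h1 : f u v ∈ genWeightSpace (TrivialLieModule ℂ t ℂ) (χ₁ + χ₂) :=
    apply_mem_genWeightSpace f hu hv
  have h2 := disjoint_genWeightSpace ℂ t (TrivialLieModule ℂ t ℂ) hχ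
  rw [zero_genWeightSpace_eq_top_of_nilpotent', disjoint_top] at h2
  rw [h2] at h1
  have h3 : φ (σ u v) = 0 := (LieSubmodule.mem_bot _).1 h1
  simpa using h3

theorem exists_apply_ne_zero_of_mem_genWeightSpace (hn : σ.Nondegenerate)
    (hg : g ≤ skewAdjointLieSubalgebra σ) {χ : t → ℂ} {u : F} (hu : u ∈ genWeightSpace F χ)
    (hu0 : u ≠ 0) : ∃ v ∈ genWeightSpace F (-χ), σ u v ≠ 0 := by
  by_contra! hcon
  refine hu0 (hn.1 u fun v => ?_)
  have hv : v ∈ ⨆ χ : t → ℂ, genWeightSpace F χ := by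
    rw [iSup_genWeightSpace_eq_top ℂ t F]; trivial
  induction hv using LieSubmodule.iSup_induction' with
  | mem ψ v hv =>
    by_cases h : ψ = -χ
    · exact hcon v (h ▸ hv)
    · exact apply_eq_zero_of_mem_genWeightSpace t hg
        (fun h' => h (eq_neg_of_add_eq_zero_right h')) hu hv
  | zero => simp
  | add v w _ _ hv hw => rw [map_add, hv, hw, add_zero]

theorem neg_mem_weights (hn : σ.Nondegenerate) (hg : g ≤ skewAdjointLieSubalgebra σ)
    {μ : Module.Dual ℂ t} (hμ : μ ∈ weights g t) : -μ ∈ weights g t := by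
  obtain ⟨w, hw⟩ := hμ
  obtain ⟨u, hu, hu0⟩ := w.exists_ne_zero
  obtain ⟨v, hv, huv⟩ := exists_apply_ne_zero_of_mem_genWeightSpace t hn hg hu hu0
  rw [mem_weights_iff]
  intro hbot
  rw [hw] at hv
  have : v ∈ genWeightSpace F ((-μ : Module.Dual ℂ t) : t → ℂ) := hv
  rw [hbot, LieSubmodule.mem_bot] at this
  simp [this] at huv

omit [FiniteDimensional ℂ F] in
theorem nontrivial_of_isCartanSubalgebra [Nontrivial g] : Nontrivial t := by
  by_contra hcon
  rw [not_nontrivial_iff_subsingleton] at hcon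
  obtain ⟨x, hx⟩ := exists_ne (0 : g)
  have hbot : ∀ y ∈ t, y = 0 := fun y hy =>
    congrArg Subtype.val (Subsingleton.elim (⟨y, hy⟩ : t) 0)
  have hmem : x ∈ t.normalizer := by
    rw [LieSubalgebra.mem_normalizer_iff]
    intro y hy
    rw [hbot y hy, lie_zero]
    exact t.zero_mem
  rw [LieSubalgebra.IsCartanSubalgebra.self_normalizing] at hmem
  exact hx (hbot x hmem)

/-- Some curvature pair with nonzero vector is homogeneous for the action of a Cartan subalgebra. -/
theorem exists_homogeneous_isCurvaturePair (hg : g ≤ skewAdjointLieSubalgebra σ)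
    {A : F →ₗ[ℂ] g} {a : F} (h : IsCurvaturePair σ A a) (ha : a ≠ 0) :
    ∃ (χ : t → ℂ) (B : F →ₗ[ℂ] g) (b : F), IsCurvaturePair σ B b ∧ b ≠ 0 ∧
      b ∈ genWeightSpace F χ ∧
      ∀ (ψ : t → ℂ), ∀ u ∈ genWeightSpace F ψ, B u ∈ genWeightSpace g (χ + ψ) := by
  let X := curvaturePairs hg
  let fst : X →ₗ⁅ℂ,t⁆ (F →ₗ[ℂ] g) :=
    { toLinearMap := LinearMap.fst ℂ (F →ₗ[ℂ] g) F ∘ₗ X.toSubmodule.subtype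
      map_lie' := rfl }
  let snd : X →ₗ⁅ℂ,t⁆ F :=
    { toLinearMap := LinearMap.snd ℂ (F →ₗ[ℂ] g) F ∘ₗ X.toSubmodule.subtype
      map_lie' := rfl }
  obtain ⟨χ, p, hp, hp0⟩ : ∃ χ : t → ℂ, ∃ p ∈ genWeightSpace X χ, snd p ≠ 0 := by
    by_contra! hcon
    refine ha (?_ : snd ⟨(A, a), h⟩ = 0)
    generalize (⟨(A, a), h⟩ : X) = p
    have hp : p ∈ ⨆ χ : t → ℂ, genWeightSpace X χ := by
      rw [iSup_genWeightSpace_eq_top ℂ t X]; trivial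
    induction hp using LieSubmodule.iSup_induction' with
    | mem χ p hp => exact hcon χ p hp
    | zero => simp
    | add p q _ _ hp hq => rw [map_add, hp, hq, add_zero]
  refine ⟨χ, fst p, snd p, p.2, hp0,
    map_genWeightSpace_le snd (LieSubmodule.mem_map_of_mem hp), fun ψ u hu => ?_⟩
  exact apply_mem_genWeightSpace (LieModuleHom.id : (F →ₗ[ℂ] g) →ₗ⁅ℂ,t⁆ _)
    (map_genWeightSpace_le fst (LieSubmodule.mem_map_of_mem hp)) hu

/-- (PIII) and (PIV) for a subalgebra with a curvature pair `(A, a)`. For a homogeneous pair with `a`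
of weight `μ` the map `A` kills all weight spaces of weight `ν` with `μ + ν ∉ Δ₀`, and both properties
follow by evaluating the defining identity on weight vectors. -/
theorem properties_of_isCurvaturePair [LieAlgebra.IsKilling ℂ g] [Nontrivial g]
    (hn : σ.Nondegenerate) (hg : g ≤ skewAdjointLieSubalgebra σ)
    {A : F →ₗ[ℂ] g} {a : F} (h : IsCurvaturePair σ A a) (ha : a ≠ 0) :
    PropertyPIII g t ∧ PropertyPIV g t := by
  obtain ⟨χ, A, a, hA, ha, haχ, hAχ⟩ := exists_homogeneous_isCurvaturePair t hg h ha
  have hχ : genWeightSpace F χ ≠ ⊥ := by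
    intro hbot
    rw [hbot, LieSubmodule.mem_bot] at haχ
    exact ha haχ
  set μ : Module.Dual ℂ t := (⟨χ, hχ⟩ : Weight ℂ t F).toLinear with hμdef
  have hμχ : χ = μ := rfl
  have hμ : μ ∈ weights g t := ⟨⟨χ, hχ⟩, rfl⟩
  rw [hμχ] at haχ hAχ
  have hA0 : ∀ ν : Module.Dual ℂ t, μ + ν ∉ rootsWithZero g t → ∀ v ∈ genWeightSpace F (ν : t → ℂ),
      A v = 0 := by
    intro ν hν v hv
    have h1 : A v ∈ genWeightSpace g ((μ + ν : Module.Dual ℂ t) : t → ℂ) := hAχ _ v hv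
    rwa [genWeightSpace_eq_bot_of_notMem t hν, LieSubmodule.mem_bot] at h1
  have horth : ∀ ν ρ : Module.Dual ℂ t, ν + ρ ≠ 0 → ∀ u ∈ genWeightSpace F (ν : t → ℂ),
      ∀ v ∈ genWeightSpace F (ρ : t → ℂ), σ u v = 0 := by
    intro ν ρ hne u hu v hv
    refine apply_eq_zero_of_mem_genWeightSpace t hg (fun h0 => hne ?_) hu hv
    ext x
    exact congrFun h0 x
  have hne0 : ∀ β, β ∉ rootsWithZero g t → β ≠ 0 := by
    rintro _ hβ rfl
    exact hβ (zero_mem_rootsWithZero t)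
  constructor
  -- for (PIII) let `u` have weight `-μ` and `v` have weight `ν` with `μ + ν ∉ Δ₀` and `ν ≠ μ`: the
  -- identity becomes `A(u) v = -σ(a, u) v`, so `ν` lies on the hyperplane `ν(A(u)) = -σ(a, u)`
  · obtain ⟨u, hu, hau⟩ := exists_apply_ne_zero_of_mem_genWeightSpace t hn hg haχ ha
    have hAu : A u ∈ t := by
      have h1 := hAχ _ u hu
      rw [add_neg_cancel] at h1
      have h2 := LieAlgebra.rootSpace_zero_eq ℂ g t
      have h3 : A u ∈ LieAlgebra.rootSpace t 0 := h1
      rw [h2] at h3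
      exact h3
    set H : t := ⟨A u, hAu⟩
    have hval : ∀ ν ∈ weights g t, μ + ν ∉ rootsWithZero g t → ν ≠ μ → ν H = -σ a u := by
      rintro ν ⟨w, hw⟩ hν hνμ
      obtain ⟨v, hv0, hv⟩ := exists_forall_lie_eq_smul ℂ t F w
      have hvν : v ∈ genWeightSpace F (ν : t → ℂ) := by
        rw [← hw]
        exact weightSpace_le_genWeightSpace F _ ((mem_weightSpace _ _).2 hv)
      have h1 := hA u v
      have h2 : (A u : Module.End ℂ F) v = ν H • v := by rw [← hw]; exact hv H
      rw [h2, hA0 ν hν v hvν, horth μ ν (hne0 _ hν) a haχ v hvν,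
        horth (-μ) ν (fun h0 => hνμ (neg_add_eq_zero.1 h0).symm) u hu v hvν] at h1
      simp only [ZeroMemClass.coe_zero, LinearMap.zero_apply, sub_zero, zero_smul, zero_sub,
        mul_zero, add_zero, ← neg_smul] at h1
      exact smul_left_injective ℂ hv0 h1
    refine ⟨-μ, neg_mem_weights t hn hg hμ, ?_⟩
    -- if `A(u) = 0` there is no such `ν`, and any hyperplane will do
    by_cases hH : H = 0
    · have := nontrivial_of_isCartanSubalgebra t
      obtain ⟨x, hx⟩ := exists_ne (0 : t)
      refine ⟨{w | Module.Dual.eval ℂ t x w = 0}, ⟨Module.Dual.eval ℂ t x, ?_, 0, rfl⟩, ?_⟩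
      · rwa [Ne, Module.eval_apply_eq_zero_iff]
      · intro ν hν
        by_cases h1 : μ + ν ∈ rootsWithZero g t
        · exact Or.inl (Or.inl ⟨_, h1, by abel⟩)
        · right
          by_contra h2
          have h3 := hval ν hν h1 (by simpa using h2)
          rw [hH, map_zero] at h3
          exact hau (neg_eq_zero.1 h3.symm)
    · refine ⟨{w | Module.Dual.eval ℂ t H w = -σ a u}, ⟨Module.Dual.eval ℂ t H, ?_, _, rfl⟩, ?_⟩
      · rwa [Ne, Module.eval_apply_eq_zero_iff]
      · intro ν hν
        by_cases h1 : μ + ν ∈ rootsWithZero g t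
        · exact Or.inl (Or.inl ⟨_, h1, by abel⟩)
        · by_cases h2 : ν = μ
          · right; simp [h2]
          · exact Or.inl (Or.inr (hval ν hν h1 h2))
  -- for (PIV) let `u` and `v` have weights `ν` and `-ν` with `σ(u, v) ≠ 0`: if neither `μ + ν` nor
  -- `μ - ν` is in `Δ₀`, the identity becomes `0 = 2 σ(u, v) a`
  · refine ⟨μ, hμ, fun ν hν => ?_⟩
    by_contra hcon
    have h1 : μ + ν ∉ rootsWithZero g t := fun h1 => hcon (Or.inr ⟨_, h1, by abel⟩)
    have h2 : μ + -ν ∉ rootsWithZero g t := fun h2 =>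
      hcon (Or.inl ⟨_, neg_mem_rootsWithZero t h2, by abel⟩)
    obtain ⟨w, hw⟩ := hν
    obtain ⟨u, hu, hu0⟩ := w.exists_ne_zero
    rw [hw] at hu
    obtain ⟨v, hv, huv⟩ := exists_apply_ne_zero_of_mem_genWeightSpace t hn hg hu hu0
    have h3 := hA u v
    rw [hA0 ν h1 u hu, hA0 (-ν) h2 v hv, horth μ ν (hne0 _ h1) a haχ u hu,
      horth μ (-ν) (hne0 _ h2) a haχ v hv] at h3
    have h4 : (2 * σ u v) • a = 0 := by simpa using h3.symm
    rcases smul_eq_zero.1 h4 with h5 | h5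
    · exact huv (by simpa using h5)
    · exact ha h5

/-- In dimension at most two the weights are `μ` and `-μ`, and (PIII) and (PIV) are clear. -/
theorem properties_of_finrank_le_two [Nontrivial F] [Nontrivial g] (hn : σ.Nondegenerate)
    (hg : g ≤ skewAdjointLieSubalgebra σ) (hF : Module.finrank ℂ F ≤ 2) :
    PropertyPIII g t ∧ PropertyPIV g t := by
  obtain ⟨μ, hμ, hsub⟩ : ∃ μ ∈ weights g t, ∀ ν ∈ weights g t, ν = μ ∨ ν = -μ := by
    by_cases hz : ∃ μ ∈ weights g t, μ ≠ 0
    · obtain ⟨μ, hμ, hμ0⟩ := hz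
      refine ⟨μ, hμ, fun ν hν => ?_⟩
      by_contra! hcon
      have hμn : μ ≠ -μ := fun h0 =>
        hμ0 (LinearMap.ext fun x => self_eq_neg.1 (LinearMap.congr_fun h0 x))
      have hinj : Function.Injective ![(μ : t → ℂ), ((-μ : Module.Dual ℂ t) : t → ℂ), ν] := by
        intro i j hij
        have h1 : (μ : t → ℂ) ≠ ((-μ : Module.Dual ℂ t) : t → ℂ) :=
          fun h0 => hμn (DFunLike.coe_injective h0)
        have h2 : (ν : t → ℂ) ≠ μ := fun h0 => hcon.1 (DFunLike.coe_injective h0)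
        have h3 : (ν : t → ℂ) ≠ ((-μ : Module.Dual ℂ t) : t → ℂ) :=
          fun h0 => hcon.2 (DFunLike.coe_injective h0)
        fin_cases i <;> fin_cases j <;>
          first
          | rfl
          | exact absurd hij h1
          | exact absurd hij h2
          | exact absurd hij h3
          | exact absurd hij.symm h1
          | exact absurd hij.symm h2
          | exact absurd hij.symm h3
      have hind := (LieSubmodule.iSupIndep_toSubmodule.2
        (iSupIndep_genWeightSpace ℂ t F)).comp hinj
      have hne : ∀ i, ∃ v ∈ (genWeightSpace F
          (![(μ : t → ℂ), ((-μ : Module.Dual ℂ t) : t → ℂ), ν] i)).toSubmodule, v ≠ 0 := by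
        have hw : ∀ μ ∈ weights g t, ∃ v ∈ (genWeightSpace F (μ : t → ℂ)).toSubmodule, v ≠ 0 :=
          fun μ hμ => by
            obtain ⟨w, hw⟩ := hμ
            rw [← hw]
            exact w.exists_ne_zero
        intro i
        fin_cases i
        · exact hw μ hμ
        · exact hw (-μ) (neg_mem_weights t hn hg hμ)
        · exact hw ν hν
      choose v hv hv0 using hne
      have hli := hind.linearIndependent _ hv hv0
      have := hli.fintype_card_le_finrank
      simp at this
      omega
    · push Not at hz
      obtain ⟨w⟩ : Nonempty (Weight ℂ t F) := by
        by_contra hcon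
        rw [not_nonempty_iff] at hcon
        have := iSup_genWeightSpace_eq_top' ℂ t F
        rw [iSup_of_empty] at this
        exact bot_ne_top this
      exact ⟨w.toLinear, ⟨w, rfl⟩, fun ν hν => Or.inl ((hz ν hν).trans (hz _ ⟨w, rfl⟩).symm)⟩
  have := nontrivial_of_isCartanSubalgebra t
  obtain ⟨x, hx⟩ := exists_ne (0 : t)
  refine ⟨⟨μ, hμ, {w | Module.Dual.eval ℂ t x w = 0}, ⟨Module.Dual.eval ℂ t x, ?_, 0, rfl⟩, ?_⟩,
    μ, hμ, ?_⟩
  · rwa [Ne, Module.eval_apply_eq_zero_iff]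
  · intro ν hν
    rcases hsub ν hν with rfl | rfl
    · exact Or.inl (Or.inl ⟨0, zero_mem_rootsWithZero t, by simp⟩)
    · exact Or.inr rfl
  · intro ν hν
    rcases hsub ν hν with rfl | rfl
    · exact Or.inl ⟨0, zero_mem_rootsWithZero t, by simp⟩
    · exact Or.inr ⟨0, zero_mem_rootsWithZero t, by simp⟩

end WeightSpaces

/-! ### Commuting actions and tensor products -/

section TensorDecomposition

/-- Schur's lemma for simple modules over a complex algebra. -/
theorem exists_smul_of_isSimpleModule {R W : Type*} [Ring R] [Algebra ℂ R] [AddCommGroup W]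
    [Module ℂ W] [Module R W] [IsScalarTower ℂ R W] [FiniteDimensional ℂ W] [IsSimpleModule R W]
    (φ : W →ₗ[R] W) : ∃ c : ℂ, ∀ w, φ w = c • w := by
  have := IsSimpleModule.nontrivial R W
  obtain ⟨c, hc⟩ := Module.End.exists_eigenvalue (φ.restrictScalars ℂ)
  obtain ⟨w, hw⟩ := hc.exists_hasEigenvector
  have hker : LinearMap.ker (φ - algebraMap ℂ (Module.End R W) c) = ⊤ := by
    refine (eq_bot_or_eq_top _).resolve_left fun h => hw.2 ?_
    have hmem : w ∈ LinearMap.ker (φ - algebraMap ℂ (Module.End R W) c) := by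
      rw [LinearMap.mem_ker, LinearMap.sub_apply, Module.algebraMap_end_apply, sub_eq_zero]
      exact hw.apply_eq_smul
    rwa [h, Submodule.mem_bot] at hmem
  refine ⟨c, fun w => ?_⟩
  have hmem : w ∈ LinearMap.ker (φ - algebraMap ℂ (Module.End R W) c) := hker ▸ Submodule.mem_top
  rwa [LinearMap.mem_ker, LinearMap.sub_apply, Module.algebraMap_end_apply, sub_eq_zero] at hmem

/-- An isotypic module `F` of type `W` is a tensor product of `W` with a multiplicity space: the ring
acts on the first factor, and its commutant acts on the second one. -/
theorem exists_tensor_equiv_of_isotypic {R F : Type*} [Ring R] [Algebra ℂ R] [AddCommGroup F]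
    [Module ℂ F] [Module R F] [IsScalarTower ℂ R F] [FiniteDimensional ℂ F] (W : Submodule R F)
    [IsSimpleModule R W] (htop : isotypicComponent R F W = ⊤) :
    ∃ (p q : ℕ) (e : F ≃ₗ[ℂ] (Fin p → ℂ) ⊗[ℂ] (Fin q → ℂ)),
      (∀ r : R, ∃ A : Module.End ℂ (Fin p → ℂ), ∀ x, e (r • x) = A.rTensor (Fin q → ℂ) (e x)) ∧
      (∀ t : F →ₗ[R] F, ∃ B : Module.End ℂ (Fin q → ℂ),
        ∀ x, e (t x) = B.lTensor (Fin p → ℂ) (e x)) := by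
  have : Module.Finite R F := Module.Finite.of_restrictScalars_finite ℂ R F
  have hss : IsSemisimpleModule R F := by
    have h1 : IsSemisimpleModule R (isotypicComponent R F W) := inferInstance
    exact IsSemisimpleModule.congr (LinearEquiv.ofTop _ htop).symm
  obtain ⟨q, ⟨e₀⟩⟩ := (IsIsotypicOfType.of_isotypicComponent_eq_top htop).linearEquiv_fun
  have : FiniteDimensional ℂ W :=
    inferInstanceAs (FiniteDimensional ℂ (W.restrictScalars ℂ))
  let eW : W ≃ₗ[ℂ] (Fin (Module.finrank ℂ W) → ℂ) := (Module.finBasis ℂ W).equivFun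
  let e : F ≃ₗ[ℂ] (Fin (Module.finrank ℂ W) → ℂ) ⊗[ℂ] (Fin q → ℂ) :=
    (e₀.restrictScalars ℂ).trans ((LinearEquiv.piCongrRight fun _ => eW).trans
      (TensorProduct.piScalarRight ℂ ℂ (Fin (Module.finrank ℂ W) → ℂ) (Fin q)).symm)
  have he : ∀ x y, e.symm (x ⊗ₜ y) = e₀.symm fun j => y j • eW.symm x := by
    intro x y
    simp only [e, LinearEquiv.trans_symm, LinearEquiv.trans_apply, LinearEquiv.symm_symm,
      TensorProduct.piScalarRight_apply, TensorProduct.piScalarRightHom_tmul]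
    change e₀.symm _ = _
    congr 1
    ext j : 1
    simp
  refine ⟨_, q, e, fun r => ?_, fun t => ?_⟩
  · let l : W →ₗ[ℂ] W := Module.toModuleEnd ℂ (S := R) W r
    refine ⟨eW.conj l, ?_⟩
    suffices H : ∀ z, e (r • e.symm z) = (eW.conj l).rTensor (Fin q → ℂ) z by
      intro x
      rw [← H, e.symm_apply_apply]
    intro z
    induction z with
    | zero => simp
    | add x y hx hy => rw [map_add, smul_add, map_add, hx, hy, map_add]
    | tmul x y =>
      refine e.symm.injective ?_
      rw [LinearEquiv.symm_apply_apply, LinearMap.rTensor_tmul, he, he, ← map_smul]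
      congr 1
      ext j : 1
      simp only [Pi.smul_apply, LinearEquiv.conj_apply_apply, LinearEquiv.symm_apply_apply]
      exact smul_comm r (y j) (eW.symm x)
  · have hc : ∀ k j : Fin q, ∃ c : ℂ, ∀ w : W, e₀ (t (e₀.symm (Pi.single j w))) k = c • w := by
      intro k j
      exact exists_smul_of_isSimpleModule (LinearMap.proj k ∘ₗ e₀.toLinearMap ∘ₗ t ∘ₗ
        e₀.symm.toLinearMap ∘ₗ LinearMap.single R (fun _ => W) j)
    choose c hc using hc
    refine ⟨Matrix.toLin' (Matrix.of c), ?_⟩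
    suffices H : ∀ z, e (t (e.symm z)) =
        (Matrix.toLin' (Matrix.of c)).lTensor (Fin (Module.finrank ℂ W) → ℂ) z by
      intro x
      rw [← H, e.symm_apply_apply]
    intro z
    induction z with
    | zero => simp
    | add x y hx hy => rw [map_add, map_add, map_add, hx, hy, map_add]
    | tmul x y =>
      refine e.symm.injective (e₀.injective ?_)
      rw [LinearEquiv.symm_apply_apply, LinearMap.lTensor_tmul, he, he,
        LinearEquiv.apply_symm_apply]
      ext k : 1
      have hsum : (fun j => y j • eW.symm x) = ∑ j, Pi.single j (y j • eW.symm x) :=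
        (Finset.univ_sum_single _).symm
      rw [hsum, map_sum, map_sum, map_sum, Finset.sum_apply]
      simp only [hc, smul_smul, ← Finset.sum_smul]
      congr 1

/-- If two commuting sets `S` and `T` of endomorphisms together act irreducibly on `F`, then `F` is
a tensor product on whose factors `S` and `T` act separately. -/
theorem exists_tensor_equiv {F : Type*} [AddCommGroup F] [Module ℂ F] [FiniteDimensional ℂ F]
    [Nontrivial F] (S T : Set (Module.End ℂ F)) (hcomm : ∀ s ∈ S, ∀ t ∈ T, s * t = t * s)
    (hirr : ∀ W : Submodule ℂ F, (∀ s ∈ S, ∀ w ∈ W, s w ∈ W) → (∀ t ∈ T, ∀ w ∈ W, t w ∈ W) →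
      W = ⊥ ∨ W = ⊤) :
    ∃ (p q : ℕ) (e : F ≃ₗ[ℂ] (Fin p → ℂ) ⊗[ℂ] (Fin q → ℂ)),
      (∀ s ∈ S, ∃ A : Module.End ℂ (Fin p → ℂ), e.conj s = A.rTensor (Fin q → ℂ)) ∧
      (∀ t ∈ T, ∃ B : Module.End ℂ (Fin q → ℂ), e.conj t = B.lTensor (Fin p → ℂ)) := by
  let R := Algebra.adjoin ℂ S
  have : IsArtinian R F := isArtinian_of_tower ℂ inferInstance
  obtain ⟨W, hW⟩ := IsAtomic.exists_atom (Submodule R F)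
  rw [← isSimpleModule_iff_isAtom] at hW
  -- elements of `T` are `R`-linear
  have hT : ∀ t ∈ T, ∃ t' : F →ₗ[R] F, ∀ x, t' x = t x := by
    intro t ht
    refine ⟨{ toFun := t, map_add' := map_add t, map_smul' := ?_ }, fun x => rfl⟩
    rintro ⟨r, hr⟩ x
    have hrt : r * t = t * r := by
      induction hr using Algebra.adjoin_induction with
      | mem s hs => exact hcomm s hs t ht
      | algebraMap c => exact Algebra.commutes c t
      | add r s _ _ hr hs => rw [add_mul, mul_add, hr, hs]
      | mul r s _ _ hr hs => rw [mul_assoc, hs, ← mul_assoc, hr, mul_assoc]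
    exact (LinearMap.congr_fun hrt x).symm
  have htop : isotypicComponent R F W = ⊤ := by
    rcases hirr ((isotypicComponent R F W).restrictScalars ℂ)
      (fun s hs w hw => (isotypicComponent R F W).smul_mem
        (⟨s, Algebra.subset_adjoin hs⟩ : R) hw)
      (fun t ht w hw => by
        obtain ⟨t', ht'⟩ := hT t ht
        rw [← ht']
        exact LinearMap.le_comap_isotypicComponent W t' hw) with h | h
    · have h1 := bot_lt_isotypicComponent W
      rw [Submodule.restrictScalars_eq_bot_iff] at h
      exact absurd h h1.ne'
    · rwa [Submodule.restrictScalars_eq_top_iff] at h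
  obtain ⟨p, q, e, hS, hC⟩ := exists_tensor_equiv_of_isotypic W htop
  refine ⟨p, q, e, fun s hs => ?_, fun t ht => ?_⟩
  · obtain ⟨A, hA⟩ := hS ⟨s, Algebra.subset_adjoin hs⟩
    refine ⟨A, LinearMap.ext fun z => ?_⟩
    have h1 := hA (e.symm z)
    rw [e.apply_symm_apply] at h1
    rw [LinearEquiv.conj_apply_apply, ← h1]
    rfl
  · obtain ⟨t', ht'⟩ := hT t ht
    obtain ⟨B, hB⟩ := hC t'
    refine ⟨B, LinearMap.ext fun z => ?_⟩
    have h1 := hB (e.symm z)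
    rw [e.apply_symm_apply, ht'] at h1
    rw [LinearEquiv.conj_apply_apply, ← h1]

end TensorDecomposition

/-! ### Invariant forms -/

section InvariantForms

variable {M N : Type*} [AddCommGroup M] [Module ℂ M] [AddCommGroup N] [Module ℂ N]

theorem tensorSum_map_comm (g₁ : LieSubalgebra ℂ (Module.End ℂ M))
    (g₂ : LieSubalgebra ℂ (Module.End ℂ N)) :
    (tensorSum g₁ g₂).map (TensorProduct.comm ℂ M N).lieConj.toLieHom = tensorSum g₂ g₁ := by
  have key : ∀ (A : Module.End ℂ M) (B : Module.End ℂ N),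
      (TensorProduct.comm ℂ M N).conj (A.rTensor N + B.lTensor M)
        = B.rTensor M + A.lTensor N := by
    intro A B
    ext x y
    simp [LinearEquiv.conj_apply, add_comm]
  ext T
  constructor
  · rintro ⟨_, ⟨A, hA, B, hB, rfl⟩, rfl⟩
    exact ⟨B, hB, A, hA, key A B⟩
  · rintro ⟨B, hB, A, hA, rfl⟩
    exact ⟨_, ⟨A, hA, B, hB, rfl⟩, key A B⟩

theorem ActsIrreducibly.of_tensorSum_left [Nontrivial N] {g₁ : LieSubalgebra ℂ (Module.End ℂ M)}
    {g₂ : LieSubalgebra ℂ (Module.End ℂ N)} (h : ActsIrreducibly (tensorSum g₁ g₂)) :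
    ActsIrreducibly g₁ := by
  have h1 := h.map (TensorProduct.comm ℂ M N)
  rw [tensorSum_map_comm] at h1
  exact h1.of_tensorSum

/-- Schur's lemma. -/
theorem ActsIrreducibly.exists_smul_of_commute [FiniteDimensional ℂ M] [Nontrivial M]
    {g : LieSubalgebra ℂ (Module.End ℂ M)} (h : ActsIrreducibly g) {T : Module.End ℂ M}
    (hT : ∀ A ∈ g, ∀ x, T (A x) = A (T x)) : ∃ c : ℂ, ∀ x, T x = c • x := by
  obtain ⟨c, hc⟩ := Module.End.exists_eigenvalue T
  refine ⟨c, fun x => ?_⟩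
  have h1 : Module.End.eigenspace T c = ⊤ := by
    refine (h _ fun A hA x hx => ?_).resolve_left hc
    rw [Module.End.mem_eigenspace_iff] at hx ⊢
    rw [hT A hA, hx, map_smul]
  exact Module.End.mem_eigenspace_iff.1 (h1 ▸ Submodule.mem_top)

theorem ActsIrreducibly.nondegenerate [FiniteDimensional ℂ M]
    {g : LieSubalgebra ℂ (Module.End ℂ M)} (h : ActsIrreducibly g) {β : BilinForm ℂ M}
    (hg : g ≤ skewAdjointLieSubalgebra β) (hβ : β ≠ 0) : β.Nondegenerate := by
  refine LinearMap.BilinForm.Nondegenerate.ofSeparatingLeft ?_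
  rw [LinearMap.separatingLeft_iff_ker_eq_bot]
  refine (h _ fun A hA x hx => ?_).resolve_right fun h => hβ (LinearMap.ker_eq_top.1 h)
  rw [LinearMap.mem_ker] at hx ⊢
  ext y
  rw [(mem_skewAdjoint_iff β A).1 (hg hA), hx]
  simp

theorem ActsIrreducibly.exists_form_eq_smul [FiniteDimensional ℂ M] [Nontrivial M]
    {g : LieSubalgebra ℂ (Module.End ℂ M)} (h : ActsIrreducibly g) {β γ : BilinForm ℂ M}
    (hβ : β.Nondegenerate) (hg : g ≤ skewAdjointLieSubalgebra β)
    (hg' : g ≤ skewAdjointLieSubalgebra γ) : ∃ c : ℂ, ∀ x y, γ x y = c * β x y := by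
  let T : Module.End ℂ M := (β.toDual hβ).symm.toLinearMap ∘ₗ γ
  have hT : ∀ x y, β (T x) y = γ x y := fun x y =>
    LinearMap.BilinForm.apply_toDual_symm_apply (hB := hβ) (γ x) y
  obtain ⟨c, hc⟩ := h.exists_smul_of_commute (T := T) fun A hA x => by
    rw [← sub_eq_zero]
    refine hβ.1 _ fun y => ?_
    rw [map_sub, LinearMap.sub_apply, hT, (mem_skewAdjoint_iff β A).1 (hg hA), hT,
      (mem_skewAdjoint_iff γ A).1 (hg' hA), sub_self]
  refine ⟨c, fun x y => ?_⟩
  rw [← hT, hc, map_smul, LinearMap.smul_apply, smul_eq_mul]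

/-- A nondegenerate form that is invariant under an irreducible Lie algebra is symmetric or
alternating, since it is proportional to its transpose. -/
theorem ActsIrreducibly.isSymm_or_isAlt [FiniteDimensional ℂ M] [Nontrivial M]
    {g : LieSubalgebra ℂ (Module.End ℂ M)} (h : ActsIrreducibly g) {β : BilinForm ℂ M}
    (hβ : β.Nondegenerate) (hg : g ≤ skewAdjointLieSubalgebra β) : β.IsSymm ∨ β.IsAlt := by
  obtain ⟨c, hc⟩ := h.exists_form_eq_smul (γ := LinearMap.flip β) hβ hg fun A hA =>
    (mem_skewAdjoint_iff _ A).2 fun x y => by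
      rw [LinearMap.flip_apply, LinearMap.flip_apply, (mem_skewAdjoint_iff β A).1 (hg hA), neg_neg]
  simp only [LinearMap.flip_apply] at hc
  obtain ⟨x, hx⟩ := exists_ne (0 : M)
  obtain ⟨y, hy⟩ : ∃ y, β x y ≠ 0 := by
    by_contra! hy
    exact hx (hβ.1 x hy)
  have hcc : c * c = 1 := by
    have h1 := hc y x
    rw [hc x y, ← mul_assoc] at h1
    exact mul_right_cancel₀ hy (by rw [one_mul]; exact h1.symm)
  rcases mul_self_eq_one_iff.1 hcc with rfl | rfl
  · left
    exact ⟨fun x y => by rw [hc x y, one_mul]⟩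
  · right
    intro x
    have h1 := hc x x
    have h2 : (2 : ℂ) * β x x = 0 := by linear_combination h1
    simpa using h2

/-- An invariant form of an irreducible tensor product is the product of invariant forms of the
factors. -/
theorem exists_forms_of_tensorSum [FiniteDimensional ℂ M] [FiniteDimensional ℂ N] [Nontrivial M]
    [Nontrivial N] {g₁ : LieSubalgebra ℂ (Module.End ℂ M)}
    {g₂ : LieSubalgebra ℂ (Module.End ℂ N)} (h : ActsIrreducibly (tensorSum g₁ g₂))
    {τ : BilinForm ℂ (M ⊗[ℂ] N)} (hτ : τ ≠ 0)
    (hle : tensorSum g₁ g₂ ≤ skewAdjointLieSubalgebra τ) :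
    ∃ (β : BilinForm ℂ M) (s : BilinForm ℂ N), β.Nondegenerate ∧ s.Nondegenerate ∧
      g₁ ≤ skewAdjointLieSubalgebra β ∧ g₂ ≤ skewAdjointLieSubalgebra s ∧
      τ = tensorForm β s := by
  have h1 : ∀ A ∈ g₁, ∀ x y v w, τ (A x ⊗ₜ v) (y ⊗ₜ w) = - τ (x ⊗ₜ v) (A y ⊗ₜ w) := by
    intro A hA x y v w
    have := (mem_skewAdjoint_iff τ _).1 (hle ⟨A, hA, 0, g₂.zero_mem, rfl⟩) (x ⊗ₜ v) (y ⊗ₜ w)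
    simpa using this
  have h2 : ∀ B ∈ g₂, ∀ x y v w, τ (x ⊗ₜ B v) (y ⊗ₜ w) = - τ (x ⊗ₜ v) (y ⊗ₜ B w) := by
    intro B hB x y v w
    have := (mem_skewAdjoint_iff τ _).1 (hle ⟨0, g₁.zero_mem, B, hB, rfl⟩) (x ⊗ₜ v) (y ⊗ₜ w)
    simpa using this
  obtain ⟨x₀, v₀, y₀, w₀, h0⟩ : ∃ x v y w, τ (x ⊗ₜ v) (y ⊗ₜ w) ≠ 0 := by
    by_contra! h0
    exact hτ (TensorProduct.ext' fun x v => TensorProduct.ext' fun y w => h0 x v y w)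
  -- by Schur's lemma all the invariant forms `b v w` on `M` are proportional to `b v₀ w₀`
  let b (v w : N) : BilinForm ℂ M :=
    τ.compl₁₂ ((TensorProduct.mk ℂ M N).flip v) ((TensorProduct.mk ℂ M N).flip w)
  have hb : ∀ v w x y, b v w x y = τ (x ⊗ₜ v) (y ⊗ₜ w) := fun v w x y => rfl
  have hbg : ∀ v w, g₁ ≤ skewAdjointLieSubalgebra (b v w) := fun v w A hA =>
    (mem_skewAdjoint_iff _ A).2 fun x y => h1 A hA x y v w
  have hn : (b v₀ w₀).Nondegenerate := h.of_tensorSum_left.nondegenerate (hbg _ _) fun hz =>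
    h0 (by rw [← hb, hz]; rfl)
  let s : BilinForm ℂ N := (τ (x₀ ⊗ₜ v₀) (y₀ ⊗ₜ w₀))⁻¹ •
    τ.compl₁₂ (TensorProduct.mk ℂ M N x₀) (TensorProduct.mk ℂ M N y₀)
  have hs : ∀ v w, s v w = (τ (x₀ ⊗ₜ v₀) (y₀ ⊗ₜ w₀))⁻¹ * τ (x₀ ⊗ₜ v) (y₀ ⊗ₜ w) :=
    fun v w => rfl
  have hsg : g₂ ≤ skewAdjointLieSubalgebra s := fun B hB =>
    (mem_skewAdjoint_iff _ B).2 fun v w => by rw [hs, hs, h2 B hB, mul_neg]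
  refine ⟨b v₀ w₀, s, hn, h.of_tensorSum.nondegenerate hsg fun hz => ?_, hbg _ _, hsg,
    TensorProduct.ext' fun x v => TensorProduct.ext' fun y w => ?_⟩
  · have h3 := hs v₀ w₀
    rw [hz, inv_mul_cancel₀ h0] at h3
    exact zero_ne_one h3
  · obtain ⟨c, hc⟩ := h.of_tensorSum_left.exists_form_eq_smul hn (hbg v₀ w₀) (hbg v w)
    have h3 := hc x y
    have h4 := hc x₀ y₀
    simp only [hb] at h3 h4
    rw [tensorForm_tmul, hs, h3, h4, hb]
    field_simp

end InvariantForms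

/-! ### Decomposition of non-simple symplectic Lie algebras -/

section Decomposition

variable {F : Type*} [AddCommGroup F] [Module ℂ F]

/-- The Lie algebra of all `A` such that `A ⊗ 1` belongs to `G`. -/
def leftFactor {M N : Type*} [AddCommGroup M] [Module ℂ M] [AddCommGroup N] [Module ℂ N]
    (G : LieSubalgebra ℂ (Module.End ℂ (M ⊗[ℂ] N))) : LieSubalgebra ℂ (Module.End ℂ M) where
  carrier := {A | A.rTensor N ∈ G}
  zero_mem' := by simp
  add_mem' := by
    intro A B hA hB
    rw [Set.mem_ofPred_eq, LinearMap.rTensor_add]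
    exact G.add_mem hA hB
  smul_mem' := by
    intro c A hA
    rw [Set.mem_ofPred_eq, LinearMap.rTensor_smul]
    exact G.smul_mem c hA
  lie_mem' := by
    intro A B hA hB
    have h : ⁅A, B⁆.rTensor N = ⁅A.rTensor N, B.rTensor N⁆ := by
      simp only [Ring.lie_def, LinearMap.rTensor_sub, LinearMap.rTensor_mul]
    change ⁅A, B⁆.rTensor N ∈ G
    rw [h]
    exact G.lie_mem hA hB

/-- The Lie algebra of all `B` such that `1 ⊗ B` belongs to `G`. -/
def rightFactor {M N : Type*} [AddCommGroup M] [Module ℂ M] [AddCommGroup N] [Module ℂ N]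
    (G : LieSubalgebra ℂ (Module.End ℂ (M ⊗[ℂ] N))) : LieSubalgebra ℂ (Module.End ℂ N) where
  carrier := {B | B.lTensor M ∈ G}
  zero_mem' := by simp
  add_mem' := by
    intro A B hA hB
    rw [Set.mem_ofPred_eq, LinearMap.lTensor_add]
    exact G.add_mem hA hB
  smul_mem' := by
    intro c A hA
    rw [Set.mem_ofPred_eq, LinearMap.lTensor_smul]
    exact G.smul_mem c hA
  lie_mem' := by
    intro A B hA hB
    have h : ⁅A, B⁆.lTensor M = ⁅A.lTensor M, B.lTensor M⁆ := by
      simp only [Ring.lie_def, LinearMap.lTensor_sub, LinearMap.lTensor_mul]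
    change ⁅A, B⁆.lTensor M ∈ G
    rw [h]
    exact G.lie_mem hA hB

theorem exists_lie_ne_zero_of_ne_bot {L : Type*} [LieRing L] [LieAlgebra ℂ L]
    [LieAlgebra.HasTrivialRadical ℂ L] {I : LieIdeal ℂ L} (hI : I ≠ ⊥) :
    ∃ x ∈ I, ∃ y ∈ I, ⁅x, y⁆ ≠ 0 := by
  by_contra! h
  have : IsLieAbelian I := ⟨fun x y => Subtype.ext (h x x.2 y y.2)⟩
  exact hI (LieAlgebra.HasTrivialRadical.eq_bot_of_isSolvable I)

/-- A symplectic irreducible Lie algebra without solvable ideals that is not simple is the sum of a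
symplectic and an orthogonal Lie algebra, acting on a tensor product. -/
theorem exists_symplectic_tensorSum_orthogonal [FiniteDimensional ℂ F] [Nontrivial F]
    {g : LieSubalgebra ℂ (Module.End ℂ F)} [LieAlgebra.HasTrivialRadical ℂ g]
    (hirr : ActsIrreducibly g) {σ : BilinForm ℂ F} (hσ : σ.IsAlt) (hn : σ.Nondegenerate)
    (hg : g ≤ skewAdjointLieSubalgebra σ) {I J : LieIdeal ℂ g} (hI : I ≠ ⊥) (hJ : J ≠ ⊥)
    (hIJ : IsCompl I J) :
    ∃ (p q : ℕ) (g₁ : LieSubalgebra ℂ (Module.End ℂ (Fin p → ℂ)))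
      (g₂ : LieSubalgebra ℂ (Module.End ℂ (Fin q → ℂ))) (β : BilinForm ℂ (Fin p → ℂ))
      (s : BilinForm ℂ (Fin q → ℂ)) (e : F ≃ₗ[ℂ] (Fin p → ℂ) ⊗[ℂ] (Fin q → ℂ)),
      g.map e.lieConj.toLieHom = tensorSum g₁ g₂ ∧ (β.IsAlt ∧ β.Nondegenerate) ∧
      (s.IsSymm ∧ s.Nondegenerate) ∧ g₁ ≤ skewAdjointLieSubalgebra β ∧
      g₂ ≤ skewAdjointLieSubalgebra s ∧ (∀ v w, σ v w = tensorForm β s (e v) (e w)) ∧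
      (∃ A ∈ g₁, ∃ B ∈ g₁, A * B ≠ B * A) ∧ ∃ A ∈ g₂, ∃ B ∈ g₂, A * B ≠ B * A := by
  let S (I : LieIdeal ℂ g) : Set (Module.End ℂ F) := {T | ∃ x ∈ I, (x : Module.End ℂ F) = T}
  have hsum : ∀ x : g, ∃ y ∈ I, ∃ z ∈ J, y + z = x := by
    intro x
    have h1 : x ∈ I ⊔ J := by rw [hIJ.sup_eq_top]; exact LieSubmodule.mem_top x
    exact (LieSubmodule.mem_sup I J x).1 h1
  have hne : ∀ I : LieIdeal ℂ g, I ≠ ⊥ → ∃ A ∈ S I, ∃ B ∈ S I, A * B ≠ B * A := by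
    intro I hI
    obtain ⟨x, hx, y, hy, hxy⟩ := exists_lie_ne_zero_of_ne_bot hI
    refine ⟨_, ⟨x, hx, rfl⟩, _, ⟨y, hy, rfl⟩, fun h => hxy (Subtype.ext ?_)⟩
    change (x : Module.End ℂ F) * y - y * x = 0
    rw [h, sub_self]
  obtain ⟨p, q, e, hS, hT⟩ := exists_tensor_equiv (S I) (S J) (by
      rintro _ ⟨x, hx, rfl⟩ _ ⟨y, hy, rfl⟩
      have h1 : ⁅x, y⁆ ∈ I ⊓ J := ⟨lie_mem_left ℂ g I x y hx, lie_mem_right ℂ g J x y hy⟩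
      rw [hIJ.inf_eq_bot, LieSubmodule.mem_bot] at h1
      exact sub_eq_zero.1 (congrArg Subtype.val h1))
    (fun W hW₁ hW₂ => hirr W fun A hA w hw => by
      obtain ⟨y, hy, z, hz, hyz⟩ := hsum ⟨A, hA⟩
      have h1 : A = (y : Module.End ℂ F) + z := (congrArg Subtype.val hyz).symm
      rw [h1, LinearMap.add_apply]
      exact add_mem (hW₁ _ ⟨y, hy, rfl⟩ w hw) (hW₂ _ ⟨z, hz, rfl⟩ w hw))
  have hmap : ∀ x : g, e.conj x ∈ g.map e.lieConj.toLieHom := fun x => ⟨x, x.2, rfl⟩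
  have hmul : ∀ S T : Module.End ℂ F, e.conj (S * T) = e.conj S * e.conj T :=
    fun S T => LinearEquiv.conj_comp e T S
  set G := g.map e.lieConj.toLieHom with hG
  have hGsum : G = tensorSum (leftFactor G) (rightFactor G) := by
    refine le_antisymm ?_ ?_
    · rintro _ ⟨T, hT', rfl⟩
      obtain ⟨y, hy, z, hz, hyz⟩ := hsum ⟨T, hT'⟩
      have h1 : T = (y : Module.End ℂ F) + z := (congrArg Subtype.val hyz).symm
      obtain ⟨A, hA⟩ := hS _ ⟨y, hy, rfl⟩
      obtain ⟨B, hB⟩ := hT _ ⟨z, hz, rfl⟩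
      refine ⟨A, ?_, B, ?_, ?_⟩
      · change A.rTensor _ ∈ G
        rw [← hA]; exact hmap y
      · change B.lTensor _ ∈ G
        rw [← hB]; exact hmap z
      · rw [← hA, ← hB, ← map_add, ← h1]
        rfl
    · rintro _ ⟨A, hA, B, hB, rfl⟩
      exact G.add_mem hA hB
  have hne₁ : ∃ A ∈ leftFactor G, ∃ B ∈ leftFactor G, A * B ≠ B * A := by
    obtain ⟨_, ⟨x, hx, rfl⟩, _, ⟨y, hy, rfl⟩, hxy⟩ := hne I hI
    obtain ⟨A, hA⟩ := hS _ ⟨x, hx, rfl⟩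
    obtain ⟨B, hB⟩ := hS _ ⟨y, hy, rfl⟩
    refine ⟨A, ?_, B, ?_, fun h => hxy (e.conj.injective ?_)⟩
    · change A.rTensor _ ∈ G
      rw [← hA]; exact hmap x
    · change B.rTensor _ ∈ G
      rw [← hB]; exact hmap y
    · rw [hmul, hmul, hA, hB, ← LinearMap.rTensor_mul, h,
        LinearMap.rTensor_mul]
  have hne₂ : ∃ A ∈ rightFactor G, ∃ B ∈ rightFactor G, A * B ≠ B * A := by
    obtain ⟨_, ⟨x, hx, rfl⟩, _, ⟨y, hy, rfl⟩, hxy⟩ := hne J hJ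
    obtain ⟨A, hA⟩ := hT _ ⟨x, hx, rfl⟩
    obtain ⟨B, hB⟩ := hT _ ⟨y, hy, rfl⟩
    refine ⟨A, ?_, B, ?_, fun h => hxy (e.conj.injective ?_)⟩
    · change A.lTensor _ ∈ G
      rw [← hA]; exact hmap x
    · change B.lTensor _ ∈ G
      rw [← hB]; exact hmap y
    · rw [hmul, hmul, hA, hB, ← LinearMap.lTensor_mul, h,
        LinearMap.lTensor_mul]
  have hnt : Nontrivial ((Fin p → ℂ) ⊗[ℂ] (Fin q → ℂ)) := e.symm.toEquiv.nontrivial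
  have hp : Nontrivial (Fin p → ℂ) := by
    rw [← not_subsingleton_iff_nontrivial]
    intro h
    obtain ⟨f, hf⟩ := exists_ne (0 : Module.End ℂ ((Fin p → ℂ) ⊗[ℂ] (Fin q → ℂ)))
    refine hf (TensorProduct.ext' fun x y => ?_)
    rw [Subsingleton.elim x 0]
    simp
  have hq : Nontrivial (Fin q → ℂ) := by
    rw [← not_subsingleton_iff_nontrivial]
    intro h
    obtain ⟨f, hf⟩ := exists_ne (0 : Module.End ℂ ((Fin p → ℂ) ⊗[ℂ] (Fin q → ℂ)))
    refine hf (TensorProduct.ext' fun x y => ?_)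
    rw [Subsingleton.elim y 0]
    simp
  let τ : BilinForm ℂ ((Fin p → ℂ) ⊗[ℂ] (Fin q → ℂ)) :=
    σ.compl₁₂ e.symm.toLinearMap e.symm.toLinearMap
  have hτ : ∀ v w, τ (e v) (e w) = σ v w := fun v w => by simp [τ]
  have hτ0 : τ ≠ 0 := by
    intro h0
    obtain ⟨v, hv⟩ := exists_ne (0 : F)
    exact hv (hn.1 v fun w => by rw [← hτ, h0]; rfl)
  have hτalt : τ.IsAlt := fun x => hσ _
  have hGτ : tensorSum (leftFactor G) (rightFactor G) ≤ skewAdjointLieSubalgebra τ := by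
    rw [← hGsum, ← map_skewAdjoint e hτ]
    rintro _ ⟨T, hT', rfl⟩
    exact ⟨T, hg hT', rfl⟩
  have hGirr : ActsIrreducibly (tensorSum (leftFactor G) (rightFactor G)) :=
    hGsum ▸ hirr.map e
  obtain ⟨β, s, hβ, hs, hβg, hsg, hτeq⟩ := exists_forms_of_tensorSum hGirr hτ0 hGτ
  have hprod : ∀ x y v w, β x y * s v w = - (β y x * s w v) := by
    intro x y v w
    rw [← tensorForm_tmul, ← tensorForm_tmul, ← hτeq, hτalt.neg_eq]
  obtain ⟨x, hx⟩ := exists_ne (0 : Fin p → ℂ)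
  obtain ⟨y, hy⟩ : ∃ y, β x y ≠ 0 := by
    by_contra! hy
    exact hx (hβ.1 x hy)
  obtain ⟨v, hv⟩ := exists_ne (0 : Fin q → ℂ)
  obtain ⟨w, hw⟩ : ∃ w, s v w ≠ 0 := by
    by_contra! hw
    exact hv (hs.1 v hw)
  -- the product is alternating, so its factors are of opposite types; swap them if necessary
  have hxy := hprod x y v w
  rcases hGirr.of_tensorSum_left.isSymm_or_isAlt hβ hβg with hβ' | hβ' <;>
    rcases hGirr.of_tensorSum.isSymm_or_isAlt hs hsg with hs' | hs'
  · rw [hβ'.eq y x, hs'.eq w v] at hxy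
    exact absurd (self_eq_neg.1 hxy) (mul_ne_zero hy hw)
  · refine ⟨q, p, rightFactor G, leftFactor G, s, β, e.trans (TensorProduct.comm ℂ _ _), ?_,
      ⟨hs', hs⟩, ⟨hβ', hβ⟩, hsg, hβg, ?_, hne₂, hne₁⟩
    · rw [map_lieConj_trans, ← hG, ← tensorSum_map_comm, ← hGsum]
    · have h1 : τ = (tensorForm s β).compl₁₂ (TensorProduct.comm ℂ _ _).toLinearMap
          (TensorProduct.comm ℂ _ _).toLinearMap := by
        rw [hτeq]
        refine TensorProduct.ext' fun x v => TensorProduct.ext' fun y w => ?_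
        simp [mul_comm]
      intro v w
      rw [← hτ, h1]
      rfl
  · exact ⟨p, q, leftFactor G, rightFactor G, β, s, e, hGsum, ⟨hβ', hβ⟩, ⟨hs', hs⟩, hβg, hsg,
      fun v w => by rw [← hτ, hτeq], hne₁, hne₂⟩
  · rw [← hβ'.neg_eq y x, ← hs'.neg_eq w v, neg_mul_neg] at hxy
    exact absurd (self_eq_neg.1 hxy) (by
      refine mul_ne_zero ?_ ?_
      · rw [← hβ'.neg_eq y x] at hy; simpa using hy
      · rw [← hs'.neg_eq w v] at hw; simpa using hw)

end Decomposition

/-! ### Curvature pairs on tensor products -/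

section CurvatureOnTensorProducts

variable {M N : Type*} [AddCommGroup M] [Module ℂ M] [AddCommGroup N] [Module ℂ N]

theorem exists_tensorSum_components {g₁ : LieSubalgebra ℂ (Module.End ℂ M)}
    {g₂ : LieSubalgebra ℂ (Module.End ℂ N)} {C : M ⊗[ℂ] N → Module.End ℂ (M ⊗[ℂ] N)}
    (hC : ∀ u, C u ∈ tensorSum g₁ g₂) :
    ∃ (A : M ⊗[ℂ] N → Module.End ℂ M) (B : M ⊗[ℂ] N → Module.End ℂ N), (∀ u, A u ∈ g₁) ∧
      (∀ u, B u ∈ g₂) ∧ ∀ u x y, C u (x ⊗ₜ y) = A u x ⊗ₜ y + x ⊗ₜ B u y := by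
  choose A hA B hB h using hC
  refine ⟨A, B, hA, hB, fun u x y => ?_⟩
  rw [h, LinearMap.add_apply, LinearMap.rTensor_tmul, LinearMap.lTensor_tmul]

/-- If both factors have dimension at least three, then a decomposable vector `a` is not part of a
curvature pair with values in a sum of Lie algebras acting on the factors: a suitable decomposable
functional kills all terms but the multiple of `a`. -/
theorem not_forall_curvature_of_three_le_finrank [FiniteDimensional ℂ M] [FiniteDimensional ℂ N]
    {β : BilinForm ℂ M} {s : BilinForm ℂ N} (hβ : β.Nondegenerate) (hs : s.Nondegenerate)
    (hM : 3 ≤ Module.finrank ℂ M) (hN : 3 ≤ Module.finrank ℂ N)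
    {g₁ : LieSubalgebra ℂ (Module.End ℂ M)} {g₂ : LieSubalgebra ℂ (Module.End ℂ N)}
    (H : ∀ a, ∃ C : M ⊗[ℂ] N → Module.End ℂ (M ⊗[ℂ] N), (∀ u, C u ∈ tensorSum g₁ g₂) ∧
      ∀ u v, C u v - C v u = tensorForm β s a v • u - tensorForm β s a u • v
        + (2 * tensorForm β s u v) • a) : False := by
  have : Nontrivial M := Module.nontrivial_of_finrank_pos (R := ℂ) (by omega)
  have : Nontrivial N := Module.nontrivial_of_finrank_pos (R := ℂ) (by omega)
  obtain ⟨u₁, hu₁⟩ := exists_ne (0 : M)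
  obtain ⟨v₁, hv₁⟩ : ∃ v, β u₁ v ≠ 0 := by
    by_contra! h
    exact hu₁ (hβ.1 _ h)
  obtain ⟨u₂, hu₂⟩ := exists_ne (0 : N)
  obtain ⟨v₂, hv₂⟩ : ∃ v, s u₂ v ≠ 0 := by
    by_contra! h
    exact hu₂ (hs.1 _ h)
  obtain ⟨a₁, ha₁⟩ := exists_notMem_span_pair hM u₁ v₁
  obtain ⟨a₂, ha₂⟩ := exists_notMem_span_pair hN u₂ v₂
  obtain ⟨w₁, hw₁, h₁⟩ := exists_orthogonal_of_notMem hβ ha₁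
  obtain ⟨w₂, hw₂, h₂⟩ := exists_orthogonal_of_notMem hs ha₂
  obtain ⟨C, hC, hid⟩ := H (a₁ ⊗ₜ a₂)
  obtain ⟨A, B, -, -, hAB⟩ := exists_tensorSum_components hC
  have h := congrArg (tensorForm β s (w₁ ⊗ₜ w₂)) (hid (u₁ ⊗ₜ u₂) (v₁ ⊗ₜ v₂))
  have hu₁' := h₁ u₁ (Submodule.subset_span (by simp))
  have hv₁' := h₁ v₁ (Submodule.subset_span (by simp))
  have hu₂' := h₂ u₂ (Submodule.subset_span (by simp))
  have hv₂' := h₂ v₂ (Submodule.subset_span (by simp))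
  simp [hAB, hu₁', hv₁', hu₂', hv₂', hv₁, hv₂, hw₁, hw₂] at h

/-- In dimension at least three every hyperplane `u⊥` contains a non-isotropic vector. -/
theorem exists_dotProduct_eq_zero {n : ℕ} (hn : 3 ≤ n) (u : Fin n → ℂ) :
    ∃ v, u ⬝ᵥ v = 0 ∧ v ⬝ᵥ v ≠ 0 := by
  by_contra! h
  have key : ∀ i j : Fin n, i ≠ j → u i * u i + u j * u j = 0 := by
    intro i j hij
    have h1 := h (u j • Pi.single i 1 - u i • Pi.single j 1) (by simp; ring)
    simpa [hij, hij.symm, add_comm] using h1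
  let i : Fin n := ⟨0, by omega⟩
  let j : Fin n := ⟨1, by omega⟩
  let k : Fin n := ⟨2, by omega⟩
  have h1 := key i j (by simp [i, j])
  have h2 := key i k (by simp [i, k])
  have h3 := key j k (by simp [j, k])
  have h4 : u i = 0 := by
    have : (2 : ℂ) * (u i * u i) = 0 := by linear_combination h1 + h2 - h3
    simpa using this
  have h5 := h (Pi.single i 1) (by simp [h4])
  simp at h5

/-- If every vector of `ℂ² ⊗ ℂⁿ` is part of a curvature pair with values in
`g₁ ⊕ g₂ ⊆ sl(2) ⊕ so(n)`, then `g₁ = sl(2)` and `g₂ = so(n)`. In fact a pair with vector `x ⊗ a`,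
where `ω(x, y) = 1`, sends `x ⊗ u` to `2 (a · u) x ω(x, ·)`, up to an element of `so(n)`, and `y ⊗ v`
to `2 a ∧ v`, up to an element of `sl(2)`. -/
theorem eq_sl2_and_eq_so {n : ℕ} (hn : 3 ≤ n) {g₁ : LieSubalgebra ℂ (Module.End ℂ (Fin 2 → ℂ))}
    {g₂ : LieSubalgebra ℂ (Module.End ℂ (Fin n → ℂ))}
    (hg₁ : g₁ ≤ skewAdjointLieSubalgebra areaForm)
    (hg₂ : g₂ ≤ skewAdjointLieSubalgebra (dotForm n))
    (H : ∀ a, ∃ C : (Fin 2 → ℂ) ⊗[ℂ] (Fin n → ℂ) → Module.End ℂ ((Fin 2 → ℂ) ⊗[ℂ] (Fin n → ℂ)),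
      (∀ u, C u ∈ tensorSum g₁ g₂) ∧
      ∀ u v, C u v - C v u = tensorForm areaForm (dotForm n) a v • u
        - tensorForm areaForm (dotForm n) a u • v
        + (2 * tensorForm areaForm (dotForm n) u v) • a) :
    g₁ = sl2 ∧ g₂ = so n := by
  have hdot : ∀ B ∈ g₂, ∀ u, u ⬝ᵥ B u = 0 := by
    intro B hB u
    have h1 : B u ⬝ᵥ u = - (u ⬝ᵥ B u) := (mem_skewAdjoint_iff _ B).1 (hg₂ hB) u u
    rw [dotProduct_comm] at h1
    exact self_eq_neg.1 h1
  have hcontr : ∀ φ : Module.Dual ℂ (Fin 2 → ℂ),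
      ∃ c : (Fin 2 → ℂ) ⊗[ℂ] (Fin n → ℂ) →ₗ[ℂ] (Fin n → ℂ),
      ∀ x u, c (x ⊗ₜ u) = φ x • u := fun φ =>
    ⟨(TensorProduct.lid ℂ _).toLinearMap ∘ₗ φ.rTensor _, fun x u => by simp⟩
  have key : ∀ (x y : Fin 2 → ℂ), areaForm x y = 1 → ∀ a : Fin n → ℂ,
      (∀ u, (2 * a ⬝ᵥ u) • (areaForm x).smulRight x ∈ g₁) ∧
      ∀ v, (2 : ℂ) • wedge (dotForm n) a v ∈ g₂ := by
    intro x y hxy a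
    have hxx : areaForm x x = 0 := by simp [areaForm_apply]; ring
    have hyy : areaForm y y = 0 := by simp [areaForm_apply]; ring
    have hexp : ∀ z, z = areaForm z y • x + areaForm x z • y := by
      intro z
      simp only [areaForm_apply] at hxy ⊢
      ext i
      fin_cases i <;> simp <;> linear_combination (-z _) * hxy
    obtain ⟨C, hC, hid⟩ := H (x ⊗ₜ a)
    obtain ⟨A, B, hA, hB, hAB⟩ := exists_tensorSum_components hC
    obtain ⟨c, hc⟩ := hcontr (areaForm x)
    obtain ⟨d, hd⟩ : ∃ d : (Fin 2 → ℂ) ⊗[ℂ] (Fin n → ℂ) →ₗ[ℂ] (Fin n → ℂ),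
      ∀ z u, d (z ⊗ₜ u) = areaForm z y • u := hcontr (LinearMap.flip areaForm y)
    -- the identity for two vectors `x ⊗ u`, `x ⊗ v`
    have hf : ∀ u, areaForm x (A (x ⊗ₜ u) x) = 0 := by
      intro u
      obtain ⟨v, hv⟩ := exists_notMem_span_pair (K := ℂ) (M := Fin n → ℂ) (by simpa using hn) u u
      by_contra h0
      have h1 := congrArg c (hid (x ⊗ₜ u) (x ⊗ₜ v))
      simp only [hAB, map_sub, map_add, map_zero, hc, tensorForm_tmul, hxx, zero_mul, zero_smul,
        mul_zero, add_zero, sub_zero] at h1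
      rw [sub_eq_zero] at h1
      refine hv ?_
      rw [Set.pair_eq_singleton, Submodule.mem_span_singleton]
      exact ⟨(areaForm x (A (x ⊗ₜ u) x))⁻¹ * areaForm x (A (x ⊗ₜ v) x), by
        rw [mul_smul, ← h1, inv_smul_smul₀ h0]⟩
    -- the identity for `x ⊗ u`, `y ⊗ v`, contracted with `ω(x, ·)`
    have hQ : ∀ u v, areaForm x (A (x ⊗ₜ u) y) • v + B (x ⊗ₜ u) v
        - areaForm x (A (y ⊗ₜ v) x) • u = 0 := by
      intro u v
      have h1 := congrArg c (hid (x ⊗ₜ u) (y ⊗ₜ v))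
      simp only [hAB, map_sub, map_add, map_smul, hc, tensorForm_tmul, hxx, hxy, zero_mul,
        zero_smul, smul_zero, add_zero, sub_zero, one_smul] at h1
      exact h1
    -- evaluate `v · B v = 0` at a non-isotropic vector `v` orthogonal to `u`
    have hp : ∀ u, areaForm x (A (x ⊗ₜ u) y) = 0 := by
      intro u
      obtain ⟨v, huv, hvv⟩ := exists_dotProduct_eq_zero hn u
      have h1 := congrArg (fun z => v ⬝ᵥ z) (hQ u v)
      simp only [dotProduct_sub, dotProduct_add, dotProduct_smul, hdot _ (hB _), smul_eq_mul,
        dotProduct_zero, dotProduct_comm v u, huv, mul_zero, add_zero, sub_zero] at h1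
      exact (mul_eq_zero.1 h1).resolve_right hvv
    -- the same identity, contracted with `ω(·, y)`
    have hR : ∀ u v, B (y ⊗ₜ v) u = areaForm (A (x ⊗ₜ u) y) y • v
        - (areaForm (A (y ⊗ₜ v) x) y + a ⬝ᵥ v) • u - (2 * u ⬝ᵥ v) • a := by
      intro u v
      have h1 := congrArg d (hid (x ⊗ₜ u) (y ⊗ₜ v))
      simp only [hAB, map_sub, map_add, map_smul, hd, tensorForm_tmul, hxx,
        hyy, hxy, zero_mul, zero_smul, add_zero, sub_zero, one_smul, one_mul,
        dotForm_apply] at h1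
      rw [add_smul]
      linear_combination (exp := 1) -h1
    have hκ : ∀ v, areaForm (A (y ⊗ₜ v) x) y + a ⬝ᵥ v = 0 := by
      intro v
      obtain ⟨u, hvu, huu⟩ := exists_dotProduct_eq_zero hn v
      have h1 := congrArg (fun z => u ⬝ᵥ z) (hR u v)
      simp only [dotProduct_sub, dotProduct_smul, hdot _ (hB _), smul_eq_mul,
        dotProduct_comm u v, hvu, mul_zero, zero_mul, sub_zero, zero_sub] at h1
      exact (mul_eq_zero.1 (neg_eq_zero.1 h1.symm)).resolve_right huu
    have hμ : ∀ u, areaForm (A (x ⊗ₜ u) y) y = 2 * a ⬝ᵥ u := by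
      intro u
      by_cases hu : u = 0
      · have h1 := congrFun (hR u (Pi.single ⟨0, by omega⟩ 1)) ⟨0, by omega⟩
        rw [hκ] at h1
        subst hu
        simpa using h1.symm
      · obtain ⟨i, hi⟩ := Function.ne_iff.1 hu
        have h1 := congrArg (fun z => u ⬝ᵥ z) (hR u (Pi.single i 1))
        rw [hκ] at h1
        simp only [dotProduct_sub, dotProduct_smul, hdot _ (hB _), smul_eq_mul,
          dotProduct_single, mul_one, zero_mul, sub_zero] at h1
        rw [dotProduct_comm a u]
        refine mul_right_cancel₀ hi ?_
        linear_combination -h1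
    constructor
    · intro u
      have h1 : A (x ⊗ₜ u) = (2 * a ⬝ᵥ u) • (areaForm x).smulRight x := by
        have hy : areaForm (A (x ⊗ₜ u) x) y = 0 := by
          rw [(mem_skewAdjoint_iff _ _).1 (hg₁ (hA _)), hp, neg_zero]
        have hAx : A (x ⊗ₜ u) x = 0 := by
          rw [hexp (A (x ⊗ₜ u) x), hf, hy, zero_smul, zero_smul, add_zero]
        have hAy : A (x ⊗ₜ u) y = (2 * a ⬝ᵥ u) • x := by
          rw [hexp (A (x ⊗ₜ u) y), hp, hμ, zero_smul, add_zero]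
        refine LinearMap.ext fun z => ?_
        conv_lhs => rw [hexp z]
        rw [map_add, map_smul, map_smul, hAx, hAy, smul_zero, zero_add, LinearMap.smul_apply,
          LinearMap.smulRight_apply, smul_comm]
      rw [← h1]
      exact hA _
    · intro v
      have h1 : B (y ⊗ₜ v) = (2 : ℂ) • wedge (dotForm n) a v := by
        refine LinearMap.ext fun u => ?_
        rw [hR, hκ, hμ, LinearMap.smul_apply, wedge_apply, dotForm_apply, dotForm_apply,
          dotProduct_comm u v]
        module
      rw [← h1]
      exact hB _
  have hone : ∀ x : Fin 2 → ℂ, x ≠ 0 → ∃ y, areaForm x y = 1 := by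
    intro x hx
    by_cases h0 : x 0 = 0
    · have h1 : x 1 ≠ 0 := fun h1 => hx (by ext i; fin_cases i <;> assumption)
      exact ⟨![-(x 1)⁻¹, 0], by simp [h1]⟩
    · exact ⟨![0, (x 0)⁻¹], by simp [h0]⟩
  refine ⟨le_antisymm (skewAdjoint_areaForm ▸ hg₁) (sl2_le_of_smulRight_mem g₁ fun x => ?_),
    le_antisymm (skewAdjoint_dotForm n ▸ hg₂) (so_le_of_wedge_mem g₂ fun a v => ?_)⟩
  · by_cases hx : x = 0
    · rw [hx, LinearMap.smulRight_zero]
      exact g₁.zero_mem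
    · obtain ⟨y, hxy⟩ := hone x hx
      have h1 := (key x y hxy (Pi.single ⟨0, by omega⟩ 1)).1 (Pi.single ⟨0, by omega⟩ 1)
      simpa using g₁.smul_mem (1 / 2) h1
  · have h1 := (key (Pi.single 0 1) (Pi.single 1 1) (by simp) a).2 v
    simpa using g₂.smul_mem (1 / 2) h1

end CurvatureOnTensorProducts

/-! ### The non-simple case -/

section Nonsimple

theorem mul_comm_of_le_one {p : ℕ} (hp : p ≤ 1) (A B : Module.End ℂ (Fin p → ℂ)) :
    A * B = B * A := by
  have : Subsingleton (Fin p) := Fin.subsingleton_iff_le_one.2 hp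
  refine LinearMap.toMatrix'.injective ?_
  rw [Module.End.mul_eq_comp, Module.End.mul_eq_comp, LinearMap.toMatrix'_comp,
    LinearMap.toMatrix'_comp]
  ext i j
  rw [Matrix.mul_apply, Matrix.mul_apply]
  refine Finset.sum_congr rfl fun k _ => ?_
  rw [Subsingleton.elim k i, Subsingleton.elim j i, mul_comm]

theorem mul_comm_of_mem_so {n : ℕ} (hn : n ≤ 2) {A B : Module.End ℂ (Fin n → ℂ)} (hA : A ∈ so n)
    (hB : B ∈ so n) : A * B = B * A := by
  obtain ⟨S, hS, rfl⟩ := hA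
  obtain ⟨T, hT, rfl⟩ := hB
  change Matrix.toLin' S * Matrix.toLin' T = Matrix.toLin' T * Matrix.toLin' S
  have hS' : ∀ i j, S j i = - S i j := by
    intro i j
    exact congrFun₂ ((LieAlgebra.Orthogonal.mem_so (Fin n) ℂ S).1 hS) i j
  have hT' : ∀ i j, T j i = - T i j := by
    intro i j
    exact congrFun₂ ((LieAlgebra.Orthogonal.mem_so (Fin n) ℂ T).1 hT) i j
  rw [Module.End.mul_eq_comp, Module.End.mul_eq_comp, ← Matrix.toLin'_mul, ← Matrix.toLin'_mul]
  congr 1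
  ext i j
  have hdS : ∀ i, S i i = 0 := fun i => self_eq_neg.1 (hS' i i)
  have hdT : ∀ i, T i i = 0 := fun i => self_eq_neg.1 (hT' i i)
  interval_cases n
  · exact i.elim0
  · fin_cases i; fin_cases j; simp [Matrix.mul_apply, hdS]
  · fin_cases i <;> fin_cases j <;>
      simp [Matrix.mul_apply, hdS, hdT, hS' 0 1, hT' 0 1, mul_comm (S 0 1)]

/-- A non-simple `g` with curvature pairs is `sl(2) ⊕ so(n)`. -/
theorem exists_map_eq_tensorSum_sl2_so {F : Type*} [AddCommGroup F] [Module ℂ F]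
    [FiniteDimensional ℂ F] [Nontrivial F] {g : LieSubalgebra ℂ (Module.End ℂ F)}
    [LieAlgebra.HasTrivialRadical ℂ g] (hirr : ActsIrreducibly g) {σ : BilinForm ℂ F}
    (hσ : σ.IsAlt) (hn : σ.Nondegenerate) (hg : g ≤ skewAdjointLieSubalgebra σ)
    {I J : LieIdeal ℂ g} (hI : I ≠ ⊥) (hJ : J ≠ ⊥) (hIJ : IsCompl I J)
    (hcurv : 3 ≤ Module.finrank ℂ F → ∀ a, ∃ A : F →ₗ[ℂ] g, IsCurvaturePair σ A a) :
    ∃ n : ℕ, 3 ≤ n ∧ ∃ e : F ≃ₗ[ℂ] (Fin 2 → ℂ) ⊗[ℂ] (Fin n → ℂ),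
      g.map e.lieConj.toLieHom = tensorSum sl2 (so n) := by
  obtain ⟨p, q, g₁, g₂, β, s, e, hmap, ⟨hβ, hβn⟩, ⟨hs, hsn⟩, hg₁, hg₂, hσe, ⟨A₁, hA₁, B₁, hB₁, h₁⟩,
    A₂, hA₂, B₂, hB₂, h₂⟩ := exists_symplectic_tensorSum_orthogonal hirr hσ hn hg hI hJ hIJ
  -- the two summands are not abelian, which bounds the dimensions from below
  have hp : 2 ≤ p := by
    by_contra! hp
    exact h₁ (mul_comm_of_le_one (by omega) A₁ B₁)
  obtain ⟨e₂, he₂⟩ := exists_equiv_dotForm s hs hsn (n := q) (by simp)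
  have hso : (skewAdjointLieSubalgebra s).map e₂.lieConj.toLieHom = so q := by
    rw [map_skewAdjoint e₂ he₂, skewAdjoint_dotForm]
  have hq : 3 ≤ q := by
    by_contra! hq
    refine h₂ (e₂.conj.injective ?_)
    have h3 := mul_comm_of_mem_so (n := q) (by omega) (hso ▸ ⟨A₂, hg₂ hA₂, rfl⟩ : e₂.conj A₂ ∈ so q)
      (hso ▸ ⟨B₂, hg₂ hB₂, rfl⟩ : e₂.conj B₂ ∈ so q)
    exact (LinearEquiv.conj_comp e₂ B₂ A₂).trans (h3.trans (LinearEquiv.conj_comp e₂ A₂ B₂).symm)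
  have hF : Module.finrank ℂ F = p * q := by
    rw [e.finrank_eq, Module.finrank_tensorProduct, Module.finrank_fin_fun, Module.finrank_fin_fun]
  have hcurv' := hcurv (by rw [hF]; nlinarith)
  -- curvature pairs are transported along every isomorphism
  have htrans : ∀ {M N : Type} [AddCommGroup M] [Module ℂ M] [AddCommGroup N] [Module ℂ N]
      {g₁ : LieSubalgebra ℂ (Module.End ℂ M)} {g₂ : LieSubalgebra ℂ (Module.End ℂ N)}
      (E : F ≃ₗ[ℂ] M ⊗[ℂ] N) {β : BilinForm ℂ M} {s : BilinForm ℂ N},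
      g.map E.lieConj.toLieHom = tensorSum g₁ g₂ →
      (∀ v w, tensorForm β s (E v) (E w) = σ v w) →
      ∀ a, ∃ C : M ⊗[ℂ] N → Module.End ℂ (M ⊗[ℂ] N), (∀ u, C u ∈ tensorSum g₁ g₂) ∧
        ∀ u v, C u v - C v u = tensorForm β s a v • u - tensorForm β s a u • v
          + (2 * tensorForm β s u v) • a := by
    intro M N _ _ _ _ g₁ g₂ E β s hE hform a
    obtain ⟨A, hA⟩ := hcurv' (E.symm a)
    refine ⟨fun u => E.conj (A (E.symm u)), fun u => ?_, fun u v => ?_⟩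
    · rw [← hE]
      exact ⟨_, (A (E.symm u)).2, rfl⟩
    · have h3 := congrArg E (hA (E.symm u) (E.symm v))
      simp only [map_sub, map_add, map_smul, ← hform, E.apply_symm_apply] at h3
      rw [← h3, LinearEquiv.conj_apply_apply, LinearEquiv.conj_apply_apply]
  obtain rfl : p = 2 := by
    by_contra hp2
    exact not_forall_curvature_of_three_le_finrank hβn hsn (by simp; omega) (by simpa using hq)
      (htrans e hmap fun v w => (hσe v w).symm)
  obtain ⟨e₁, he₁⟩ := exists_equiv_areaForm β hβ hβn (by simp)
  have hmap' : g.map (e.trans (TensorProduct.congr e₁ e₂)).lieConj.toLieHom =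
      tensorSum (g₁.map e₁.lieConj.toLieHom) (g₂.map e₂.lieConj.toLieHom) := by
    rw [map_lieConj_trans, hmap, tensorSum_map_congr]
  have hform : tensorForm β s = (tensorForm areaForm (dotForm q)).compl₁₂
      (TensorProduct.congr e₁ e₂).toLinearMap (TensorProduct.congr e₁ e₂).toLinearMap := by
    refine TensorProduct.ext' fun x v => TensorProduct.ext' fun y w => ?_
    rw [tensorForm_tmul, ← he₁, ← he₂]
    exact (tensorForm_tmul ..).symm
  obtain ⟨h3, h4⟩ := eq_sl2_and_eq_so hq
    (g₁ := g₁.map e₁.lieConj.toLieHom) (g₂ := g₂.map e₂.lieConj.toLieHom)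
    (by
      rw [← map_skewAdjoint e₁ he₁]
      rintro _ ⟨T, hT, rfl⟩
      exact ⟨T, hg₁ hT, rfl⟩)
    (by
      rw [← map_skewAdjoint e₂ he₂]
      rintro _ ⟨T, hT, rfl⟩
      exact ⟨T, hg₂ hT, rfl⟩)
    (htrans _ hmap' fun v w => by rw [hσe, hform]; rfl)
  exact ⟨q, hq, _, by rw [hmap', h3, h4]⟩

end Nonsimple

end WeakBerger

open WeakBerger

theorem proposition2p12 {V₂ : Type*} [AddCommGroup V₂] [Module ℂ V₂] [FiniteDimensional ℂ V₂]
    (g₂ : LieSubalgebra ℂ (Module.End ℂ V₂))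
    (h : LinearMap.BilinForm ℂ ((Fin 2 → ℂ) ⊗[ℂ] V₂))
    (hss : LieAlgebra.IsSemisimple ℂ (WeakBerger.tensorSum WeakBerger.sl2 g₂))
    (hirr : LieModule.IsIrreducible ℂ (WeakBerger.tensorSum WeakBerger.sl2 g₂)
      ((Fin 2 → ℂ) ⊗[ℂ] V₂))
    (hwb : WeakBerger.IsWeakBerger h (WeakBerger.tensorSum WeakBerger.sl2 g₂)) :
    (LieAlgebra.IsSimple ℂ g₂ ∧ LieModule.IsIrreducible ℂ g₂ V₂ ∧ WeakBerger.IsSymplectic g₂ ∧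
      ∀ (t : LieSubalgebra ℂ g₂) [t.IsCartanSubalgebra],
        WeakBerger.PropertyPIII g₂ t ∧ WeakBerger.PropertyPIV g₂ t) ∨
    (∃ n : ℕ, 3 ≤ n ∧
      ∃ (e : V₂ ≃ₗ[ℂ] (Fin 2 → ℂ) ⊗[ℂ] (Fin n → ℂ))
        (f : (Fin 2 → ℂ) ⊗[ℂ] (Fin 2 → ℂ) ≃ₗ[ℂ] (Fin 4 → ℂ)),
        g₂.map e.lieConj.toLieHom
          = WeakBerger.tensorSum WeakBerger.sl2 (WeakBerger.so n) ∧
        (WeakBerger.tensorSum WeakBerger.sl2 WeakBerger.sl2).map f.lieConj.toLieHom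
          = WeakBerger.so 4 ∧
        (WeakBerger.tensorSum WeakBerger.sl2 g₂).map
          (((TensorProduct.congr (LinearEquiv.refl ℂ (Fin 2 → ℂ)) e).trans
            (TensorProduct.assoc ℂ (Fin 2 → ℂ) (Fin 2 → ℂ) (Fin n → ℂ)).symm).trans
              (TensorProduct.congr f (LinearEquiv.refl ℂ (Fin n → ℂ)))).lieConj.toLieHom
          = WeakBerger.tensorSum (WeakBerger.so 4) (WeakBerger.so n)) := by
  have hirr₂ : ActsIrreducibly g₂ := (ActsIrreducibly.of_isIrreducible hirr).of_tensorSum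
  have hnt : Nontrivial V₂ := by
    have := LieModule.nontrivial_of_isIrreducible ℂ (tensorSum sl2 g₂) ((Fin 2 → ℂ) ⊗[ℂ] V₂)
    rw [← not_subsingleton_iff_nontrivial]
    intro _
    exact not_subsingleton ((Fin 2 → ℂ) ⊗[ℂ] V₂) inferInstance
  obtain ⟨σ, hσ, hn, hg, hprod⟩ := exists_symplectic hwb.isSymm hwb.nondegenerate hwb.le_so
  have := hasTrivialRadical_of_irreducible hn hg hirr₂
  have : LieAlgebra.IsKilling ℂ g₂ := inferInstance
  have : LieAlgebra.IsSemisimple ℂ g₂ := inferInstance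
  -- were `g₂` zero, every line would be invariant, and `V₂` would be a line, which is isotropic
  have : Nontrivial g₂ := by
    rw [← not_subsingleton_iff_nontrivial]
    intro _
    obtain ⟨v, hv⟩ := exists_ne (0 : V₂)
    rcases hirr₂ (Submodule.span ℂ {v}) (fun A hA w _ => by
      have h0 : (⟨A, hA⟩ : g₂) = 0 := Subsingleton.elim _ _
      rw [show A = 0 from congrArg Subtype.val h0]
      exact Submodule.zero_mem _) with h0 | h0
    · exact hv (Submodule.span_singleton_eq_bot.1 h0)
    · refine hv (hn.1 v fun w => ?_)
      obtain ⟨c, rfl⟩ := Submodule.mem_span_singleton.1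
        (h0 ▸ Submodule.mem_top : w ∈ Submodule.span ℂ {v})
      rw [map_smul, hσ v, smul_zero]
  by_cases hsimple : ∀ I : LieIdeal ℂ g₂, I = ⊥ ∨ I = ⊤
  · left
    refine ⟨⟨hsimple, fun _ => ?_⟩, hirr₂.isIrreducible, ⟨σ, hσ, hn, hg⟩, fun t _ => ?_⟩
    · exact not_subsingleton g₂
        (LieAlgebra.subsingleton_of_hasTrivialRadical_lie_abelian ℂ g₂)
    · rcases le_or_gt (Module.finrank ℂ V₂) 2 with hF | hF
      · exact properties_of_finrank_le_two t hn hg hF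
      · obtain ⟨A, a, hA, ha⟩ := exists_isCurvaturePair hwb hσ hn hprod hg hF
        exact properties_of_isCurvaturePair t hn hg hA ha
  · right
    push Not at hsimple
    obtain ⟨I, hI, hI'⟩ := hsimple
    obtain ⟨J, hIJ⟩ := exists_isCompl I
    have hJ : J ≠ ⊥ := by
      rintro rfl
      exact hI' (eq_top_of_isCompl_bot hIJ)
    obtain ⟨n, hn3, e, he⟩ := exists_map_eq_tensorSum_sl2_so hirr₂ hσ hn hg hI hJ hIJ fun hF a => by
      obtain ⟨A, b, hA, hb⟩ := exists_isCurvaturePair hwb hσ hn hprod hg hF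
      exact forall_exists_isCurvaturePair hg hirr₂ hA hb a
    obtain ⟨f, hf⟩ := exists_equiv_so_four
    refine ⟨n, hn3, e, f, he, hf, ?_⟩
    have h1 := tensorSum_map_regroup sl2 sl2 (so n) g₂ e f he
    rw [hf] at h1
    exact h1
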